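/- All graphs are finite and simple. A graph is a caterpillar subdivision if it is a tree and some path of it contains all of its vertices of degree at least three. A graph $G$ is $F$-free if no induced subgraph of $G$ is isomorphic to $F$; $\overline{F}$ denotes the complement of $F$; and $\omega(G)$, $\alpha(G)$ denote the largest cardinality of a clique and of a stable (independent) set of $G$, respectively. Let $H$ and $J$ be caterpillar subdivisions. Then there exists $c>0$ such that every graph $G$ that is both $H$-free and $\overline{J}$-free satisfies $$\max(\omega(G),\alpha(G))\ge |V(G)|^c.$$ -/

import Mathlib

/-- A finite graph `H` is a caterpillar subdivision if it is a tree and some path of `H`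
contains all vertices of degree at least three. -/
def SimpleGraph.IsCaterpillarSubdivision {V : Type*} [Fintype V] (H : SimpleGraph V)
    [DecidableRel H.Adj] : Prop :=
  H.IsTree ∧ ∃ (u v : V) (p : H.Walk u v), p.IsPath ∧ ∀ w : V, 3 ≤ H.degree w → w ∈ p.support

/-- `G` is `H`-free if no induced subgraph of `G` is isomorphic to `H`. (Mathlib's
`SimpleGraph.Free` is about subgraphs that need not be induced.) -/
def SimpleGraph.IsInducedFree {V W : Type*} (G : SimpleGraph V) (H : SimpleGraph W) : Prop :=
  ¬ ∃ S : Set V, Nonempty (G.induce S ≃g H)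

/-- Induced freeness says that there is no graph embedding. -/
theorem SimpleGraph.isInducedFree_iff {V W : Type*} (G : SimpleGraph V) (H : SimpleGraph W) :
    G.IsInducedFree H ↔ ¬ H.IsIndContained G := by
  refine not_congr ⟨?_, ?_⟩
  · rintro ⟨S, ⟨e⟩⟩
    exact ⟨e.symm.toEmbedding.trans (SimpleGraph.Embedding.induce S)⟩
  · rintro ⟨f⟩
    refine ⟨Set.range f, ⟨RelIso.symm ⟨Equiv.ofInjective f f.injective, ?_⟩⟩⟩
    intro a b
    exact f.map_rel_iff

/-!
The graph `G` has no induced `H`, and its complement has no induced `J`, where `H` and `J` are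
caterpillar subdivisions. The theorem follows from the existence of linear pure pairs
(`exists_pure_pair`): every set `Y` of at least two vertices has disjoint subsets `A` and `B`, of
size at least a constant fraction of `Y.card`, between which there are all edges or none. Given
this, an induction on `Y.card` finds a clique `Q` and a stable set `R` in `Y` with
`Y.card ≤ (Q.card * R.card) ^ t`: if there are no edges between `A` and `B`, then stable sets of `A`
and `B` can be united, and the other case is the complementary one.

By Rödl's theorem (`exists_sparseSet`) it is enough to find pure pairs on a linear set on which `G`
or its complement is sparse, and passing to the complement exchanges the roles of `H` and `J`. So it
remains to be shown that a *coherent* graph, in which all degrees are small and any two disjoint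
linear sets are joined by an edge, contains every caterpillar subdivision (`Coherent.exists_has`).

To this end one maintains disjoint linear sets `X i` and rooted trees `T i` such that every vertex
of `X i` is the root of an induced copy of `T i`, and such that copies for different `i` are
disjoint, with no edges between them except possibly one joining their roots (`Pool`). Choose an
index `i` and grow a subset of `X i`, vertex by vertex, until it has neighbours in half of some
other set `X j`; as all degrees are small, the remaining sets are then still about half uncovered,
and shrinking `X j` to its covered half makes `T i` a subtree below the root of `T j`
(`Pool.move_tree`). A variant grows a connected set at the end of an induced path inside `X i`,
which hangs a long path below the root of `T j` (`Pool.move_path`). The index `i` can be chosen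
freely, but there is no control over `j`.

Caterpillars are obtained nevertheless. Let `cat d L n` be a sequence of caterpillars, with a
distinguished end of the spine as the root, in which a new leg is added to the root at each step
until it has `d` legs, and then a new root is put on top. If some root has `d` legs, move that tree,
so that there is never more than one such tree; if there is none, trade the lowest tree for a long
leg. Whatever `j` is, two trees with indices `m` and `n` become one with index at least
`max m n + 1` (`Pool.exists_merge`), so the sum of `2 ^ n` over all the trees never decreases, and
the last tree has an index at least logarithmic in the number of sets at the start. Finally, every
caterpillar subdivision is an induced subgraph of `cat d L n` for large parameters, since
superfluous legs and ends of legs can be deleted (`exists_bound_of_isCaterpillarSubdivision`).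
-/

namespace CaterpillarEH

/-! ### Rooted trees and their induced copies -/

/-- Finite rooted trees, up to the order of children: `pt` is a single vertex, and `join T C` is
obtained from `T` and `C` by making the root of `C` a child of the root of `T`. -/
inductive RTree : Type
  | pt : RTree
  | join : RTree → RTree → RTree

namespace RTree

/-- Containment of rooted trees, root to root, as generated by deleting subtrees. -/
inductive Le : RTree → RTree → Prop
  | pt (T : RTree) : Le pt T
  | join {T T' C C' : RTree} : Le T T' → Le C C' → Le (join T C) (join T' C')
  | left {T T' : RTree} (C : RTree) : Le T T' → Le T (join T' C)

theorem Le.rfl : ∀ {T : RTree}, Le T T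
  | .pt => .pt _
  | .join _ _ => .join Le.rfl Le.rfl

/-- The path with `n` edges, rooted at an end. -/
def path : ℕ → RTree
  | 0 => pt
  | n + 1 => join pt (path n)

theorem path_le_path_succ : ∀ n : ℕ, Le (path n) (path (n + 1))
  | 0 => .pt _
  | n + 1 => .join (.pt _) (path_le_path_succ n)

/-- The sequence of caterpillars with legs of length `L` that the construction climbs. Each step
adds a leg to the root, except that once the root has `d` legs (at the indices `n` with
`(d + 1) ∣ n + 1`) the next step puts a new root above the old one. -/
def cat (d L : ℕ) : ℕ → RTree
  | 0 => pt
  | n + 1 => if (d + 1) ∣ (n + 1) then join pt (cat d L n) else join (cat d L n) (path L)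

theorem Le.trans {A B C : RTree} (hAB : Le A B) (hBC : Le B C) : Le A C := by
  induction hBC generalizing A with
  | pt T => cases hAB; exact .pt _
  | join _ _ ih1 ih2 =>
    cases hAB with
    | pt => exact .pt _
    | join h1 h2 => exact .join (ih1 h1) (ih2 h2)
    | left _ h1 => exact .left _ (ih1 h1)
  | left _ _ ih => exact .left _ (ih hAB)

theorem path_le_cat {d L : ℕ} (hd : 1 ≤ d) : ∀ n : ℕ, Le (path L) (cat d L (n + 1))
  | 0 => by
    have : ¬ (d + 1) ∣ (0 + 1) := fun h => by
      have := Nat.le_of_dvd (by omega) h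
      omega
    rw [cat, if_neg this]
    exact (path_le_path_succ L).trans (.join (.pt _) .rfl)
  | n + 1 => by
    rw [cat]
    split_ifs
    · exact (path_le_path_succ L).trans (.join (.pt _) (path_le_cat hd n))
    · exact .left _ (path_le_cat hd n)

end RTree

section Trees

variable {V : Type*}

/-- The sets `A` and `B` are disjoint and there is no edge of `G` between them. -/
def Anti (G : SimpleGraph V) (A B : Set V) : Prop :=
  ∀ a ∈ A, ∀ b ∈ B, a ≠ b ∧ ¬ G.Adj a b

theorem Anti.symm {G : SimpleGraph V} {A B : Set V} (h : Anti G A B) : Anti G B A :=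
  fun b hb a ha => ⟨(h a ha b hb).1.symm, fun e => (h a ha b hb).2 e.symm⟩

theorem Anti.mono {G : SimpleGraph V} {A B A' B' : Set V} (h : Anti G A B) (hA : A' ⊆ A)
    (hB : B' ⊆ B) : Anti G A' B' :=
  fun a ha b hb => h a (hA ha) b (hB hb)

theorem Anti.union_left {G : SimpleGraph V} {A A' B : Set V} (h : Anti G A B)
    (h' : Anti G A' B) : Anti G (A ∪ A') B :=
  fun a ha b hb => ha.elim (fun ha => h a ha b hb) (fun ha => h' a ha b hb)

theorem Anti.union_right {G : SimpleGraph V} {A B B' : Set V} (h : Anti G A B)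
    (h' : Anti G A B') : Anti G A (B ∪ B') :=
  fun a ha b hb => hb.elim (fun hb => h a ha b hb) (fun hb => h' a ha b hb)

/-- `Has G T S x`: the graph `G` has an induced copy of the rooted tree `T` whose root is `x` and
whose other vertices lie in `S`. -/
def Has (G : SimpleGraph V) : RTree → Set V → V → Prop
  | .pt, _, _ => True
  | .join T C, S, x => ∃ S₁ S₂ : Set V, ∃ y : V, S₁ ⊆ S ∧ S₂ ⊆ S ∧ y ∈ S ∧ G.Adj x y ∧
      Has G T S₁ x ∧ Has G C S₂ y ∧ Anti G {x} S₂ ∧ Anti G S₁ {y} ∧ Anti G S₁ S₂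

theorem Has.mono {G : SimpleGraph V} : ∀ {T : RTree} {S S' : Set V} {x : V}, Has G T S x →
    S ⊆ S' → Has G T S' x
  | .pt, _, _, _, _, _ => trivial
  | .join _ _, _, _, _, ⟨S₁, S₂, y, h1, h2, h3, h⟩, hS =>
    ⟨S₁, S₂, y, h1.trans hS, h2.trans hS, hS h3, h⟩

theorem Has.of_le {G : SimpleGraph V} {T T' : RTree} (h : T.Le T') :
    ∀ {S : Set V} {x : V}, Has G T' S x → Has G T S x := by
  induction h with
  | pt T => intros; trivial
  | join _ _ ih1 ih2 =>
    rintro S x ⟨S₁, S₂, y, h1, h2, h3, h4, h5, h6, h⟩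
    exact ⟨S₁, S₂, y, h1, h2, h3, h4, ih1 h5, ih2 h6, h⟩
  | left _ _ ih =>
    rintro S x ⟨S₁, S₂, y, h1, h2, h3, h4, h5, h6, h⟩
    exact (ih h5).mono h1

/-! ### The universal caterpillar -/

/-- The vertices of the universal caterpillar: `(i, none)` is the `i`-th vertex of the spine, and
`(i, some (j, t))` is the `t`-th vertex of the `j`-th leg at `(i, none)`, counted from the spine. -/
abbrev UVert : Type := ℕ × Option (ℕ × ℕ)

/-- The neighbour of a vertex in the direction of `(0, none)`, which is its own parent. -/
def parent : UVert → UVert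
  | (i, some (j, t + 1)) => (i, some (j, t))
  | (i, some (_, 0)) => (i, none)
  | (i + 1, none) => (i, none)
  | (0, none) => (0, none)

/-- The infinite tree formed by a one-way infinite spine with infinitely many one-way infinite
legs at each of its vertices. -/
def univCat : SimpleGraph UVert := SimpleGraph.fromRel fun u v => parent u = v

theorem univCat_adj {u v : UVert} :
    univCat.Adj u v ↔ u ≠ v ∧ (parent u = v ∨ parent v = u) := Iff.rfl

/-- On the set `D` of vertices of `U`, the map `f` is an isomorphism onto an induced subgraph of
`G`; it sends `r` to `x`, and the rest of `D` into `S`. -/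
structure Copy {W : Type*} (G : SimpleGraph V) (U : SimpleGraph W) (D : Set W) (r : W)
    (S : Set V) (x : V) (f : W → V) : Prop where
  root : f r = x
  mem : ∀ u ∈ D, u ≠ r → f u ∈ S
  inj : ∀ u ∈ D, ∀ v ∈ D, f u = f v → u = v
  adj : ∀ u ∈ D, ∀ v ∈ D, (G.Adj (f u) (f v) ↔ U.Adj u v)

open scoped Classical in
/-- Copies of two disjoint pieces, joined by a single edge at their roots, fit together. -/
theorem Copy.glue {W : Type*} {G : SimpleGraph V} {U : SimpleGraph W} {D₁ D₂ : Set W} {r₁ r₂ : W}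
    {S S₁ S₂ : Set V} {x y : V} {f₁ f₂ : W → V} (h₁ : Copy G U D₁ r₁ S₁ x f₁)
    (h₂ : Copy G U D₂ r₂ S₂ y f₂) (hr₁ : r₁ ∈ D₁) (hr₂ : r₂ ∈ D₂)
    (hD : ∀ u ∈ D₁, ∀ v ∈ D₂, u ≠ v ∧ (U.Adj u v ↔ u = r₁ ∧ v = r₂)) (hS₁ : S₁ ⊆ S)
    (hS₂ : S₂ ⊆ S) (hy : y ∈ S) (hxy : G.Adj x y) (hx : Anti G {x} S₂) (hy' : Anti G S₁ {y})
    (hS : Anti G S₁ S₂) :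
    Copy G U (D₁ ∪ D₂) r₁ S x (fun u => if u ∈ D₂ then f₂ u else f₁ u) := by
  have hd : ∀ u ∈ D₁, u ∉ D₂ := fun u hu hu' => (hD u hu u hu').1 rfl
  have cross : ∀ u ∈ D₁, ∀ v ∈ D₂, f₁ u ≠ f₂ v ∧ (G.Adj (f₁ u) (f₂ v) ↔ U.Adj u v) := by
    intro u hu v hv
    rw [(hD u hu v hv).2]
    by_cases hur : u = r₁ <;> by_cases hvr : v = r₂
    · subst hur hvr
      rw [h₁.root, h₂.root]
      exact ⟨hxy.ne, by simp [hxy]⟩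
    · subst hur
      have := hx x rfl _ (h₂.mem v hv hvr)
      rw [h₁.root]
      simpa [hvr] using this
    · subst hvr
      have := hy' _ (h₁.mem u hu hur) y rfl
      rw [h₂.root]
      simpa [hur] using this
    · have := hS _ (h₁.mem u hu hur) _ (h₂.mem v hv hvr)
      simpa [hur] using this
  refine ⟨?_, ?_, ?_, ?_⟩
  · simp [hd _ hr₁, h₁.root]
  · rintro u (hu | hu) hur
    · simpa [hd _ hu] using hS₁ (h₁.mem u hu hur)
    · by_cases h : u = r₂
      · subst h
        simpa [hu, h₂.root] using hy
      · simpa [hu] using hS₂ (h₂.mem u hu h)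
  · rintro u (hu | hu) v (hv | hv) huv
    · simp only [hd _ hu, hd _ hv, if_false] at huv
      exact h₁.inj u hu v hv huv
    · simp only [hd _ hu, hv, if_false, if_true] at huv
      exact ((cross u hu v hv).1 huv).elim
    · simp only [hd _ hv, hu, if_false, if_true] at huv
      exact ((cross v hv u hu).1 huv.symm).elim
    · simp only [hu, hv, if_true] at huv
      exact h₂.inj u hu v hv huv
  · rintro u (hu | hu) v (hv | hv)
    · simpa only [hd _ hu, hd _ hv, if_false] using h₁.adj u hu v hv
    · simpa only [hd _ hu, hv, if_false, if_true] using (cross u hu v hv).2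
    · simpa only [hd _ hv, hu, if_false, if_true, G.adj_comm, U.adj_comm]
        using (cross v hv u hu).2
    · simpa only [hu, hv, if_true] using h₂.adj u hu v hv

theorem Copy.singleton {W : Type*} (G : SimpleGraph V) (U : SimpleGraph W) (r : W) (S : Set V)
    (x : V) : Copy G U {r} r S x (fun _ => x) := by
  refine ⟨rfl, ?_, ?_, ?_⟩ <;> simp

theorem Copy.congr {W : Type*} {G : SimpleGraph V} {U : SimpleGraph W} {D D' : Set W} {r : W}
    {S : Set V} {x : V} {f : W → V} (h : Copy G U D r S x f) (hD : D = D') :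
    Copy G U D' r S x f := hD ▸ h

theorem exists_copy_of_has_path {G : SimpleGraph V} (i j : ℕ) : ∀ (n t : ℕ) {S : Set V} {x : V},
    Has G (RTree.path n) S x →
      ∃ f, Copy G univCat {u | ∃ s, t ≤ s ∧ s ≤ t + n ∧ u = (i, some (j, s))} (i, some (j, t)) S x f
  | 0, t, S, x, _ => by
    refine ⟨_, (Copy.singleton G univCat (i, some (j, t)) S x).congr ?_⟩
    ext u
    simp only [Set.mem_singleton_iff, Set.mem_ofPred_eq]
    constructor
    · rintro rfl
      exact ⟨t, by simp⟩
    · rintro ⟨s, h1, h2, rfl⟩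
      obtain rfl : s = t := by omega
      rfl
  | n + 1, t, S, x, ⟨S₁, S₂, y, h1, h2, h3, h4, _, h6, h7, h8, h9⟩ => by
    obtain ⟨f, hf⟩ := exists_copy_of_has_path i j n (t + 1) h6
    refine ⟨_, ((Copy.singleton G univCat (i, some (j, t)) S₁ x).glue hf rfl
      ⟨t + 1, by simp⟩ ?_ h1 h2 h3 h4 h7 h8 h9).congr ?_⟩
    · rintro _ rfl _ ⟨s, hs1, hs2, rfl⟩
      have hts : t ≠ s := by omega
      refine ⟨by simp [hts], ?_⟩
      rw [univCat_adj]
      cases t <;> cases s <;> simp [parent] <;> omega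
    · ext u
      simp only [Set.mem_union, Set.mem_singleton_iff, Set.mem_ofPred_eq]
      constructor
      · rintro (rfl | ⟨s, h1, h2, rfl⟩)
        · exact ⟨t, by simp⟩
        · exact ⟨s, by omega, by omega, rfl⟩
      · rintro ⟨s, h1, h2, rfl⟩
        rcases eq_or_ne s t with rfl | h
        · exact .inl rfl
        · exact .inr ⟨s, by omega, by omega, rfl⟩

/-- The part of the universal caterpillar in which the spine is cut off at `(k, none)`, the legs
have length `L`, the last spine vertex has `a` legs, and the others have `d`. -/
def box (d L k a : ℕ) : Set UVert :=
  {u | (∃ i ≤ k, u = (i, none)) ∨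
    ∃ i j t, t ≤ L ∧ (i < k ∧ j < d ∨ i = k ∧ j < a) ∧ u = (i, some (j, t))}

/-- A copy of `cat d L n` is a copy of the box with `k = n / (d + 1)` and `a = n % (d + 1)`. -/
theorem exists_copy_of_has_cat {G : SimpleGraph V} {d L : ℕ} : ∀ (n k a : ℕ) {S : Set V} {x : V},
    n = (d + 1) * k + a → a ≤ d → Has G (RTree.cat d L n) S x →
      ∃ f, Copy G univCat (box d L k a) (k, none) S x f
  | 0, k, a, S, x, hn, ha, _ => by
    have h0 : k = 0 ∧ a = 0 := by
      have := Nat.eq_zero_of_add_eq_zero hn.symm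
      simpa using this
    obtain ⟨rfl, rfl⟩ := h0
    refine ⟨_, (Copy.singleton G univCat (0, none) S x).congr ?_⟩
    ext u
    simp [box]
  | n + 1, k, 0, S, x, hn, ha, h => by
    obtain ⟨k, rfl⟩ : ∃ k', k = k' + 1 := Nat.exists_eq_succ_of_ne_zero (by rintro rfl; simp at hn)
    rw [RTree.cat, if_pos ⟨k + 1, by simpa using hn⟩] at h
    obtain ⟨S₁, S₂, y, h1, h2, h3, h4, _, h6, h7, h8, h9⟩ := h
    obtain ⟨f, hf⟩ := exists_copy_of_has_cat n k d (by
      have : (d + 1) * (k + 1) = (d + 1) * k + d + 1 := by ring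
      omega) le_rfl h6
    refine ⟨_, ((Copy.singleton G univCat (k + 1, none) S₁ x).glue hf rfl
      (.inl ⟨k, le_rfl, rfl⟩) ?_ h1 h2 h3 h4 h7 h8 h9).congr ?_⟩
    · rintro _ rfl _ (⟨i, hi, rfl⟩ | ⟨i, j, t, ht, hij, rfl⟩)
      · refine ⟨by simp; omega, ?_⟩
        rw [univCat_adj]
        cases i <;> simp [parent] <;> omega
      · refine ⟨by simp, ?_⟩
        rw [univCat_adj]
        cases t <;> simp [parent]
        omega
    · ext u
      simp only [Set.mem_union, Set.mem_singleton_iff, box, Set.mem_ofPred_eq]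
      constructor
      · rintro (rfl | ⟨i, hi, rfl⟩ | ⟨i, j, t, ht, hij, rfl⟩)
        · exact .inl ⟨k + 1, le_rfl, rfl⟩
        · exact .inl ⟨i, by omega, rfl⟩
        · exact .inr ⟨i, j, t, ht, by omega, rfl⟩
      · rintro (⟨i, hi, rfl⟩ | ⟨i, j, t, ht, hij, rfl⟩)
        · rcases eq_or_ne i (k + 1) with rfl | h
          · exact .inl rfl
          · exact .inr (.inl ⟨i, by omega, rfl⟩)
        · exact .inr (.inr ⟨i, j, t, ht, by omega, rfl⟩)
  | n + 1, k, a + 1, S, x, hn, ha, h => by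
    have hdvd : ¬ (d + 1) ∣ (n + 1) := by
      rw [hn, ← Nat.dvd_add_iff_right (Nat.dvd_mul_right _ _)]
      intro h
      have := Nat.le_of_dvd (by omega) h
      omega
    rw [RTree.cat, if_neg hdvd] at h
    obtain ⟨S₁, S₂, y, h1, h2, h3, h4, h5, h6, h7, h8, h9⟩ := h
    obtain ⟨f, hf⟩ := exists_copy_of_has_cat n k a (by omega) (by omega) h5
    obtain ⟨g, hg⟩ := exists_copy_of_has_path k a L 0 h6
    refine ⟨_, (hf.glue hg (.inl ⟨k, le_rfl, rfl⟩) ⟨0, by simp⟩ ?_ h1 h2 h3 h4 h7 h8 h9).congr ?_⟩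
    · rintro _ (⟨i, hi, rfl⟩ | ⟨i, j, t, ht, hij, rfl⟩) _ ⟨s, -, hs, rfl⟩
      · refine ⟨by simp, ?_⟩
        rw [univCat_adj]
        cases i <;> cases s <;> simp [parent] <;> omega
      · refine ⟨by simp; omega, ?_⟩
        rw [univCat_adj]
        cases t <;> cases s <;> simp [parent] <;> omega
    · ext u
      simp only [Set.mem_union, box, Set.mem_ofPred_eq]
      constructor
      · rintro ((⟨i, hi, rfl⟩ | ⟨i, j, t, ht, hij, rfl⟩) | ⟨s, hs0, hs, rfl⟩)
        · exact .inl ⟨i, hi, rfl⟩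
        · exact .inr ⟨i, j, t, ht, by omega, rfl⟩
        · exact .inr ⟨k, a, s, by omega, by omega, rfl⟩
      · rintro (⟨i, hi, rfl⟩ | ⟨i, j, t, ht, hij, rfl⟩)
        · exact .inl (.inl ⟨i, hi, rfl⟩)
        · by_cases h : i = k ∧ j = a
          · exact .inr ⟨t, by omega, by omega, by rw [h.1, h.2]⟩
          · exact .inl (.inr ⟨i, j, t, ht, by omega, rfl⟩)

/-! ### Caterpillar subdivisions embed in the universal caterpillar -/

/-- On the connected vertex set `R`, the map `φ` is injective, and it sends every vertex to
`(0, none)` or else to the child of the image of one of its neighbours in `R`. -/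
structure PartialEmb (H : SimpleGraph V) (R : Set V) (φ : V → UVert) : Prop where
  conn : ∀ u ∈ R, ∀ v ∈ R, ∃ w : H.Walk u v, ∀ z ∈ w.support, z ∈ R
  inj : Set.InjOn φ R
  adj : ∀ u ∈ R, ∀ v ∈ R, (univCat.Adj (φ u) (φ v) ↔ H.Adj u v)
  parent : ∀ w ∈ R, φ w = (0, none) ∨ ∃ w' ∈ R, H.Adj w w' ∧ φ w' = parent (φ w)

theorem eq_of_adj_of_adj {H : SimpleGraph V} (hH : H.IsAcyclic) {R : Set V}
    (hR : ∀ u ∈ R, ∀ v ∈ R, ∃ w : H.Walk u v, ∀ z ∈ w.support, z ∈ R) {u v l : V} (hu : u ∈ R)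
    (hv : v ∈ R) (hl : l ∉ R) (hul : H.Adj u l) (hvl : H.Adj v l) : v = u := by
  classical
  by_contra hne
  obtain ⟨w, hw⟩ := hR u hu v hv
  let q : H.Walk u v := .cons hul (.cons hvl.symm .nil)
  have hq : q.IsPath := by
    simp [q, SimpleGraph.Walk.cons_isPath_iff, hul.ne, hvl.ne', Ne.symm hne]
  have := (hH.subsingleton_path u v).elim w.toPath ⟨q, hq⟩
  have hlq : l ∈ q.support := by simp [q]
  rw [show q = w.toPath from congrArg Subtype.val this.symm] at hlq
  exact hl (hw l (w.support_toPath_subset_support hlq))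

open scoped Classical in
/-- In a tree, a partial embedding extends to a neighbour `l` of its domain whenever the image of
the attachment point has a child that is not yet used. -/
theorem PartialEmb.extend {H : SimpleGraph V} (hH : H.IsAcyclic) {R : Set V} {φ : V → UVert}
    (h : PartialEmb H R φ) {u l : V} (hu : u ∈ R) (hl : l ∉ R) (hul : H.Adj u l) {x : UVert}
    (hx : CaterpillarEH.parent x = φ u) (hfresh : ∀ w ∈ R, φ w ≠ x) :
    PartialEmb H (insert l R) (Function.update φ l x) := by
  have hne : ∀ w ∈ R, w ≠ l := fun w hw e => hl (e ▸ hw)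
  have key : ∀ w ∈ R, (univCat.Adj x (φ w) ↔ H.Adj l w) := by
    intro w hw
    rw [univCat_adj]
    constructor
    · rintro ⟨-, e | e⟩
      · rw [hx] at e
        exact h.inj hu hw e ▸ hul.symm
      · rcases h.parent w hw with h0 | ⟨w', hw', -, e'⟩
        · rw [h0] at e
          exact (hfresh w hw (h0.trans e)).elim
        · exact (hfresh w' hw' (e'.trans e)).elim
    · intro hlw
      obtain rfl := eq_of_adj_of_adj hH h.conn hu hw hl hul hlw.symm
      exact ⟨(hfresh _ hu).symm, .inl hx⟩
  refine ⟨?_, ?_, ?_, ?_⟩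
  · have toL : ∀ v ∈ R, ∃ w : H.Walk v l, ∀ z ∈ w.support, z ∈ insert l R := by
      intro v hv
      obtain ⟨w, hw⟩ := h.conn v hv u hu
      refine ⟨w.append (.cons hul .nil), fun z hz => ?_⟩
      rw [SimpleGraph.Walk.mem_support_append_iff] at hz
      rcases hz with hz | hz
      · exact .inr (hw z hz)
      · simp only [SimpleGraph.Walk.support_cons, SimpleGraph.Walk.support_nil, List.mem_cons,
          List.not_mem_nil, or_false] at hz
        rcases hz with rfl | rfl
        · exact .inr hu
        · exact .inl rfl
    rintro a (rfl | ha) b (rfl | hb)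
    · exact ⟨.nil, by simp⟩
    · obtain ⟨w, hw⟩ := toL b hb
      exact ⟨w.reverse, fun z hz => hw z (by simpa using hz)⟩
    · exact toL a ha
    · obtain ⟨w, hw⟩ := h.conn a ha b hb
      exact ⟨w, fun z hz => .inr (hw z hz)⟩
  · rintro a (rfl | ha) b (rfl | hb) e
    · rfl
    · simp only [Function.update_self, Function.update_of_ne (hne b hb)] at e
      exact (hfresh b hb e.symm).elim
    · simp only [Function.update_self, Function.update_of_ne (hne a ha)] at e
      exact (hfresh a ha e).elim
    · simp only [Function.update_of_ne (hne a ha), Function.update_of_ne (hne b hb)] at e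
      exact h.inj ha hb e
  · rintro a (rfl | ha) b (rfl | hb)
    · simp
    · simpa only [Function.update_self, Function.update_of_ne (hne b hb)] using key b hb
    · simpa only [Function.update_self, Function.update_of_ne (hne a ha), SimpleGraph.adj_comm]
        using key a ha
    · simpa only [Function.update_of_ne (hne a ha), Function.update_of_ne (hne b hb)]
        using h.adj a ha b hb
  · rintro w (rfl | hw)
    · exact .inr ⟨u, .inr hu, hul.symm, by
        simp [Function.update_of_ne (hne u hu), hx]⟩
    · rw [Function.update_of_ne (hne w hw)]
      rcases h.parent w hw with h0 | ⟨w', hw', ha, e⟩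
      · exact .inl h0
      · exact .inr ⟨w', .inr hw', ha, by rw [Function.update_of_ne (hne w' hw'), e]⟩

theorem exists_partialEmb_path {H : SimpleGraph V} (hH : H.IsAcyclic) {a b : V} (p : H.Walk a b)
    (hp : p.IsPath) : ∀ n ≤ p.length, ∃ φ, PartialEmb H {v | ∃ i ≤ n, v = p.getVert i} φ ∧
      ∀ i ≤ n, φ (p.getVert i) = (i, none)
  | 0, _ => by
    refine ⟨fun _ => (0, none), ⟨?_, ?_, ?_, ?_⟩, ?_⟩
    · rintro _ ⟨i, hi, rfl⟩ _ ⟨j, hj, rfl⟩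
      obtain rfl : i = 0 := by omega
      obtain rfl : j = 0 := by omega
      exact ⟨.nil, by simp⟩
    · rintro _ ⟨i, hi, rfl⟩ _ ⟨j, hj, rfl⟩ -
      obtain rfl : i = 0 := by omega
      obtain rfl : j = 0 := by omega
      rfl
    · rintro _ ⟨i, hi, rfl⟩ _ ⟨j, hj, rfl⟩
      obtain rfl : i = 0 := by omega
      obtain rfl : j = 0 := by omega
      simp
    · exact fun _ _ => .inl rfl
    · intro i hi
      simp [Nat.le_zero.1 hi]
  | n + 1, hn => by
    classical
    obtain ⟨φ, h, hφ⟩ := exists_partialEmb_path hH p hp n (by omega)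
    have hl : p.getVert (n + 1) ∉ {v | ∃ i ≤ n, v = p.getVert i} := by
      rintro ⟨i, hi, e⟩
      have := hp.getVert_injOn (by simpa using hn) (show i ≤ p.length by omega) e
      omega
    have := h.extend hH ⟨n, le_rfl, rfl⟩ hl (p.adj_getVert_succ (by omega))
      (x := (n + 1, none)) (by rw [hφ n le_rfl]; rfl) (by
        rintro _ ⟨i, hi, rfl⟩
        rw [hφ i hi]
        intro e
        simp only [Prod.mk.injEq, and_true] at e
        omega)
    have hset : insert (p.getVert (n + 1)) {v | ∃ i ≤ n, v = p.getVert i} =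
        {v | ∃ i ≤ n + 1, v = p.getVert i} := by
      ext v
      constructor
      · rintro (rfl | ⟨i, hi, rfl⟩)
        · exact ⟨n + 1, le_rfl, rfl⟩
        · exact ⟨i, by omega, rfl⟩
      · rintro ⟨i, hi, rfl⟩
        rcases Nat.le_succ_iff.1 hi with h | rfl
        · exact .inr ⟨i, h, rfl⟩
        · exact .inl rfl
    refine ⟨_, hset ▸ this, ?_⟩
    intro i hi
    rcases Nat.le_succ_iff.1 hi with h | rfl
    · rw [Function.update_of_ne, hφ i h]
      exact fun e => hl ⟨i, h, e.symm⟩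
    · simp

theorem exists_embedding_univCat [Fintype V] {H : SimpleGraph V} [DecidableRel H.Adj]
    (hH : H.IsCaterpillarSubdivision) : Nonempty (H ↪g univCat) := by
  classical
  obtain ⟨hT, a, b, p, hp, hdeg⟩ := hH
  -- distinct legs are told apart by the index `e` of their vertex next to the spine
  let e : V → ℕ := fun v => Fintype.equivFin V v
  have he : Function.Injective e := Fin.val_injective.comp (Fintype.equivFin V).injective
  let Q : Finset V → Prop := fun R => ∃ φ : V → UVert, PartialEmb H R φ ∧
    (∀ w ∈ p.support, w ∈ R ∧ ∃ i, φ w = (i, none)) ∧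
    (∀ w ∈ R, ∀ i, φ w = (i, none) → w ∈ p.support) ∧
    ∀ w ∈ R, ∀ i j t, φ w = (i, some (j, t)) → ∃ z ∈ R, e z = j
  have hQ : Q p.support.toFinset := by
    obtain ⟨φ, h, hφ⟩ := exists_partialEmb_path hT.2 p hp p.length le_rfl
    have hs : ∀ w, w ∈ p.support ↔ ∃ i ≤ p.length, w = p.getVert i := by
      intro w
      rw [SimpleGraph.Walk.mem_support_iff_exists_getVert]
      exact ⟨fun ⟨i, h, hi⟩ => ⟨i, hi, h.symm⟩, fun ⟨i, hi, h⟩ => ⟨i, h.symm, hi⟩⟩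
    refine ⟨φ, ?_, ?_, ?_, ?_⟩
    · convert h using 1
      ext w
      simp [hs]
    · intro w hw
      obtain ⟨i, hi, rfl⟩ := (hs w).1 hw
      exact ⟨by simp, i, hφ i hi⟩
    · intro w hw i _
      simpa using hw
    · intro w hw i j t e
      obtain ⟨i, hi, rfl⟩ := (hs w).1 (by simpa using hw)
      rw [hφ i hi] at e
      simp at e
  obtain ⟨R, hR⟩ := Finite.exists_le_maximal hQ
  obtain ⟨-, ⟨φ, h, hsupp, hnone, hsome⟩, hmax⟩ := hR
  have hall : ∀ v, v ∈ R := by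
    by_contra! hv
    obtain ⟨v, hv⟩ := hv
    obtain ⟨w⟩ := hT.1.preconnected a v
    obtain ⟨⟨⟨u, l⟩, hul⟩, -, hu, hl⟩ := w.exists_boundary_dart (R : Set V)
      (hsupp a p.start_mem_support).1 hv
    simp only at hu hl hul
    have hne : ∀ w ∈ R, w ≠ l := fun w hw e => hl (e ▸ hw)
    -- an unused child of `φ u` contradicts the maximality of `R`
    have step : ∀ x : UVert, parent x = φ u → (∀ w ∈ R, φ w ≠ x) →
        (∃ i j t, x = (i, some (j, t)) ∧ ∃ z ∈ insert l R, e z = j) → False := by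
      rintro x hx hfresh ⟨i, j, t, rfl, z, hz, rfl⟩
      have hins : Q (insert l R) := by
        refine ⟨_, by simpa using h.extend hT.2 hu hl hul hx hfresh, ?_, ?_, ?_⟩
        · intro w hw
          obtain ⟨hwR, hwi⟩ := hsupp w hw
          exact ⟨Finset.mem_insert_of_mem hwR, by rwa [Function.update_of_ne (hne w hwR)]⟩
        · intro w hw i' e
          rcases Finset.mem_insert.1 hw with rfl | hw
          · simp at e
          · rw [Function.update_of_ne (hne w hw)] at e
            exact hnone w hw i' e
        · intro w hw i' j' t' e
          rcases Finset.mem_insert.1 hw with rfl | hw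
          · simp only [Function.update_self, Prod.mk.injEq, Option.some.injEq] at e
            exact ⟨z, hz, e.2.1⟩
          · rw [Function.update_of_ne (hne w hw)] at e
            obtain ⟨z', hz', e'⟩ := hsome w hw _ _ _ e
            exact ⟨z', Finset.mem_insert_of_mem hz', e'⟩
      exact hl (hmax hins (Finset.subset_insert l R) (Finset.mem_insert_self l R))
    by_cases hup : u ∈ p.support
    · obtain ⟨-, i, hi⟩ := hsupp u hup
      refine step (i, some (e l, 0)) hi.symm (fun w hw hw' => ?_)
        ⟨i, e l, 0, rfl, l, Finset.mem_insert_self l R, rfl⟩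
      obtain ⟨z, hz, hz'⟩ := hsome w hw _ _ _ hw'
      exact hl (he hz' ▸ hz)
    · obtain ⟨i, j, t, hφu⟩ : ∃ i j t, φ u = (i, some (j, t)) := by
        rcases hc : φ u with ⟨i, _ | ⟨j, t⟩⟩
        · exact (hup (hnone u hu i hc)).elim
        · exact ⟨i, j, t, rfl⟩
      obtain ⟨z, hz, hz'⟩ := hsome u hu _ _ _ hφu
      refine step (i, some (j, t + 1)) hφu.symm (fun w hw hw' => ?_)
        ⟨i, j, t + 1, rfl, z, Finset.mem_insert_of_mem hz, hz'⟩
      -- otherwise `u` has the three neighbours `l`, `w` and the one towards the spine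
      refine hup (hdeg u ?_)
      have huw : H.Adj u w := by
        rw [← h.adj u hu w hw, univCat_adj, hφu, hw']
        simp [parent]
      rcases h.parent u hu with h0 | ⟨y, hy, huy, hy'⟩
      · rw [hφu] at h0
        simp at h0
      · refine Finset.two_lt_card.2 ⟨l, by simpa using hul, w, by simpa using huw, y,
          by simpa using huy, (hne w hw).symm, (hne y hy).symm, ?_⟩
        rintro rfl
        rw [hw', hφu] at hy'
        cases t with
        | zero => simp [parent] at hy'
        | succ t =>
          simp only [parent, Prod.mk.injEq, Option.some.injEq, true_and] at hy'
          omega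
  exact ⟨⟨⟨φ, fun x y => h.inj (hall x) (hall y)⟩, fun {x y} => h.adj x (hall x) y (hall y)⟩⟩

/-- The trees `cat d L n` with large parameters contain any given caterpillar subdivision. -/
theorem exists_bound_of_isCaterpillarSubdivision [Fintype V] {H : SimpleGraph V}
    [DecidableRel H.Adj] (hH : H.IsCaterpillarSubdivision) :
    ∃ N : ℕ, ∀ d L n : ℕ, N ≤ d → N ≤ L → (d + 1) * N ≤ n →
      ∀ {X : Type*} (G : SimpleGraph X) (S : Set X) (x : X),
        Has G (RTree.cat d L n) S x → H.IsIndContained G := by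
  obtain ⟨φ⟩ := exists_embedding_univCat hH
  let size : UVert → ℕ := fun u => match u with
    | (i, none) => i
    | (i, some (j, t)) => i + j + t
  refine ⟨∑ w, size (φ w) + 1, fun d L n hd hL hn X G S x h => ?_⟩
  have hN : ∀ w, size (φ w) < ∑ w, size (φ w) + 1 := fun w =>
    Nat.lt_succ_of_le (Finset.single_le_sum (f := fun w => size (φ w)) (fun _ _ => Nat.zero_le _)
      (Finset.mem_univ w))
  generalize ∑ w, size (φ w) + 1 = N at hd hL hn hN
  obtain ⟨f, hf⟩ := exists_copy_of_has_cat n (n / (d + 1)) (n % (d + 1))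
    (Nat.div_add_mod n (d + 1)).symm (Nat.lt_succ_iff.1 (Nat.mod_lt _ (Nat.succ_pos d))) h
  have hk : N ≤ n / (d + 1) := (Nat.le_div_iff_mul_le (Nat.succ_pos d)).2 (by rwa [mul_comm])
  have hbox : ∀ w, φ w ∈ box d L (n / (d + 1)) (n % (d + 1)) := by
    intro w
    have := hN w
    rcases hw : φ w with ⟨i, _ | ⟨j, t⟩⟩ <;> rw [hw] at this <;> simp only [size] at this
    · exact .inl ⟨i, by omega, rfl⟩
    · exact .inr ⟨i, j, t, by omega, by omega, rfl⟩
  exact ⟨⟨⟨fun w => f (φ w), fun v w e => φ.injective (hf.inj _ (hbox v) _ (hbox w) e)⟩,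
    fun {v w} => (hf.adj _ (hbox v) _ (hbox w)).trans φ.map_rel_iff⟩⟩

end Trees

/-! ### Connected sets in coherent graphs -/

section Connected

open scoped Classical

variable {V : Type*} {G : SimpleGraph V} {E : ℕ}

/-- All degrees of `G` are less than `E`, and any two disjoint sets of at least `E` vertices are
joined by an edge. -/
structure Coherent (G : SimpleGraph V) (E : ℕ) : Prop where
  degree_lt : ∀ (v : V) (X : Finset V), (X.filter (G.Adj v)).card < E
  exists_adj : ∀ A B : Finset V, Disjoint A B → E ≤ A.card → E ≤ B.card →
    ∃ a ∈ A, ∃ b ∈ B, G.Adj a b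

/-- Connectedness of a set of vertices, expressed by its cuts. -/
def Conn (G : SimpleGraph V) (A : Finset V) : Prop :=
  ∀ B ⊆ A, B.Nonempty → B ≠ A → ∃ b ∈ B, ∃ a ∈ A \ B, G.Adj b a

/-- There is no edge of `G` between `D` and the rest of `W`. -/
def ClosedIn (G : SimpleGraph V) (D W : Finset V) : Prop :=
  D ⊆ W ∧ ∀ b ∈ D, ∀ a ∈ W, G.Adj b a → a ∈ D

theorem ClosedIn.sdiff {D W : Finset V} (h : ClosedIn G D W) : ClosedIn G (W \ D) W := by
  refine ⟨Finset.sdiff_subset, fun b hb a ha hab => ?_⟩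
  rw [Finset.mem_sdiff] at hb ⊢
  exact ⟨ha, fun haD => hb.2 (h.2 a haD b hb.1 hab.symm)⟩

theorem ClosedIn.trans {B D W : Finset V} (h : ClosedIn G B D) (h' : ClosedIn G D W) :
    ClosedIn G B W :=
  ⟨h.1.trans h'.1, fun b hb a ha hab => h.2 b hb a (h'.2 b (h.1 hb) a ha hab) hab⟩

/-- A minimal closed set with a property `P` is connected, provided that of two complementary
closed subsets of a closed set with the property, one has it. -/
theorem exists_conn_closedIn {W : Finset V} {P : Finset V → Prop} (hW : P W)
    (hP : ∀ D B, ClosedIn G D W → ClosedIn G B D → P D → P B ∨ P (D \ B)) :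
    ∃ D, ClosedIn G D W ∧ P D ∧ Conn G D := by
  obtain ⟨D, -, ⟨hD, hPD⟩, hmin⟩ := Finite.exists_le_minimal
    (a := (⟨W, Finset.mem_powerset_self W⟩ : W.powerset))
    (p := fun D : W.powerset => ClosedIn G D.1 W ∧ P D.1)
    ⟨⟨subset_rfl, fun _ _ _ ha _ => ha⟩, hW⟩
  refine ⟨D.1, hD, hPD, fun B hB hne hBD => ?_⟩
  by_contra! hcon
  have hBc : ClosedIn G B D.1 := ⟨hB, fun b hb a ha hab => by
    by_contra haB
    exact hcon b hb a (Finset.mem_sdiff.2 ⟨ha, haB⟩) hab⟩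
  have sub : ∀ B' : Finset V, ClosedIn G B' D.1 → P B' → D.1 ⊆ B' := fun B' h hPB =>
    hmin (y := ⟨B', Finset.mem_powerset.2 (h.1.trans hD.1)⟩) ⟨h.trans hD, hPB⟩ h.1
  rcases hP D.1 B hD hBc hPD with h | h
  · exact hBD (hB.antisymm (sub B hBc h))
  · obtain ⟨b, hb⟩ := hne
    exact (Finset.mem_sdiff.1 (sub _ hBc.sdiff h (hB hb))).2 hb

theorem exists_conn_closedIn_mem {W : Finset V} {r : V} (hr : r ∈ W) :
    ∃ D, ClosedIn G D W ∧ r ∈ D ∧ Conn G D :=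
  exists_conn_closedIn (P := fun D => r ∈ D) hr fun D B _ _ h => by
    by_cases hB : r ∈ B
    · exact .inl hB
    · exact .inr (Finset.mem_sdiff.2 ⟨h, hB⟩)

theorem Coherent.card_lt_of_closedIn (hG : Coherent G E) {D W : Finset V} (h : ClosedIn G D W) :
    D.card < E ∨ (W \ D).card < E := by
  by_contra! hcon
  obtain ⟨a, ha, b, hb, hab⟩ := hG.exists_adj D (W \ D) Finset.disjoint_sdiff hcon.1 hcon.2
  rw [Finset.mem_sdiff] at hb
  exact hb.2 (h.2 a ha b hb.1 hab)

theorem Coherent.exists_conn_large (hG : Coherent G E) {W : Finset V} (hE : 0 < E)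
    (hW : 3 * E ≤ W.card) :
    ∃ D, ClosedIn G D W ∧ (W \ D).card < E ∧ Conn G D := by
  refine exists_conn_closedIn (P := fun D => (W \ D).card < E) (by simpa) fun D B hD hB hDE => ?_
  by_contra! hcon
  have h1 := (hG.card_lt_of_closedIn (hB.trans hD)).resolve_right (by omega)
  have h2 := (hG.card_lt_of_closedIn (hB.sdiff.trans hD)).resolve_right (by omega)
  have h3 := Finset.card_sdiff_add_card_eq_card hD.1
  have h4 := Finset.card_sdiff_add_card_eq_card hB.1
  omega

theorem Conn.insert {A : Finset V} (hA : Conn G A) {v : V} (hv : ∃ a ∈ A, G.Adj a v) :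
    Conn G (insert v A) := by
  obtain ⟨a, ha, hav⟩ := hv
  intro B hB hne hBA
  by_cases hAB : A ⊆ B
  · have hvB : v ∉ B := fun h => hBA (hB.antisymm (Finset.insert_subset h hAB))
    exact ⟨a, hAB ha, v, Finset.mem_sdiff.2 ⟨Finset.mem_insert_self _ _, hvB⟩, hav⟩
  by_cases hBA' : (B ∩ A).Nonempty
  · obtain ⟨b, hb, c, hc, hbc⟩ := hA (B ∩ A) Finset.inter_subset_right hBA' (fun h =>
      hAB (h ▸ Finset.inter_subset_left))
    simp only [Finset.mem_inter, Finset.mem_sdiff, not_and] at hb hc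
    exact ⟨b, hb.1, c, Finset.mem_sdiff.2 ⟨Finset.mem_insert_of_mem hc.1,
      fun h => hc.2 h hc.1⟩, hbc⟩
  · have haB : a ∉ B := fun h => hBA' ⟨a, Finset.mem_inter.2 ⟨h, ha⟩⟩
    obtain ⟨b, hb⟩ := hne
    rcases Finset.mem_insert.1 (hB hb) with rfl | h
    · exact ⟨b, hb, a, Finset.mem_sdiff.2 ⟨Finset.mem_insert_of_mem ha, haB⟩, hav.symm⟩
    · exact (hBA' ⟨b, Finset.mem_inter.2 ⟨hb, h⟩⟩).elim

theorem Conn.singleton (v : V) : Conn G {v} := by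
  intro B hB hne hB'
  exact (hB' (hne.subset_singleton_iff.1 hB)).elim

/-- Inside any large set there is an induced path with `L` edges one end of which lies in a large
connected set that has no other contact with the path. Each step moves from the end of the path to
one of its neighbours, and gives up fewer than `2 * E` vertices of the connected set. -/
theorem Coherent.exists_path (hG : Coherent G E) (hE : 0 < E) {X : Finset V} : ∀ L : ℕ,
    (2 * L + 4) * E ≤ X.card → ∃ (A S : Finset V) (r : V), A ⊆ X ∧ S ⊆ X ∧ S.card ≤ L ∧ Conn G A ∧
      r ∈ A ∧ X.card ≤ A.card + (2 * L + 1) * E ∧ Has G (RTree.path L) S r ∧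
      Anti G S (A.erase r : Finset V)
  | 0, hX => by
    obtain ⟨D, hD, hcard, hconn⟩ := hG.exists_conn_large (W := X) hE (by omega)
    have h := Finset.card_sdiff_add_card_eq_card hD.1
    obtain ⟨r, hr⟩ : D.Nonempty := Finset.card_pos.1 (by omega)
    exact ⟨D, ∅, r, hD.1, by simp, by simp, hconn, hr, by omega, trivial, by simp [Anti]⟩
  | L + 1, hX => by
    obtain ⟨A, S, r, hAX, hSX, hSc, hA, hr, hAc, hhas, hanti⟩ :=
      hG.exists_path hE (X := X) L (by nlinarith)
    have e1 : (2 * (L + 1) + 4) * E = (2 * L + 1) * E + 5 * E := by ring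
    have e2 : (2 * (L + 1) + 1) * E = (2 * L + 1) * E + 2 * E := by ring
    rw [e1] at hX
    let W := (A.erase r).filter fun v => ¬ G.Adj r v
    have hWc : A.card ≤ W.card + E := by
      have h1 : _ + W.card = _ :=
        Finset.card_filter_add_card_filter_not (s := A.erase r) (G.Adj r)
      have h2 := hG.degree_lt r (A.erase r)
      have h3 := Finset.card_erase_add_one hr
      omega
    have hWA : W ⊆ A.erase r := Finset.filter_subset _ _
    obtain ⟨D, hD, hcard, hconn⟩ := hG.exists_conn_large (W := W) hE (by omega)
    have h := Finset.card_sdiff_add_card_eq_card hD.1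
    have hDA : D ⊆ A.erase r := hD.1.trans hWA
    obtain ⟨b, hb, a, ha, hba⟩ := hA D (hDA.trans (Finset.erase_subset _ _))
      (Finset.card_pos.1 (by omega)) (fun e => by
        have := hDA (e ▸ hr)
        simp at this)
    rw [Finset.mem_sdiff] at ha
    have hbr : ¬ G.Adj r b := (Finset.mem_filter.1 (hD.1 hb)).2
    have har : a ≠ r := by
      rintro rfl
      exact hbr hba.symm
    have hra : G.Adj r a := by
      by_contra hra
      exact ha.2 (hD.2 b hb a (Finset.mem_filter.2 ⟨Finset.mem_erase.2 ⟨har, ha.1⟩, hra⟩) hba)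
    have haA : a ∈ A.erase r := Finset.mem_erase.2 ⟨har, ha.1⟩
    refine ⟨insert a D, insert r S, a, ?_, ?_, ?_, hconn.insert ⟨b, hb, hba⟩,
      Finset.mem_insert_self _ _, ?_, ?_, ?_⟩
    · exact Finset.insert_subset (hAX ha.1) ((hDA.trans (Finset.erase_subset _ _)).trans hAX)
    · exact Finset.insert_subset (hAX hr) hSX
    · exact (Finset.card_insert_le _ _).trans (by omega)
    · rw [Finset.card_insert_of_notMem ha.2]
      omega
    · refine ⟨∅, S, r, by simp, by simp, by simp, hra.symm, trivial, hhas, ?_, by simp [Anti],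
        by simp [Anti]⟩
      intro z hz s hs
      rw [Set.mem_singleton_iff.1 hz]
      exact hanti.symm a haA s hs
    · rw [Finset.erase_insert ha.2, Finset.coe_insert, Set.insert_eq]
      refine Anti.union_left ?_ (hanti.mono subset_rfl (Finset.coe_subset.2 hDA))
      rintro _ rfl c hc
      have h1 := hD.1 hc
      exact ⟨fun e => by simp [← e, W] at h1, (Finset.mem_filter.1 h1).2⟩

/-- If a path hangs off the connected set `C`, then every vertex outside with a neighbour in `C` is
attached to a path that is at least as long and whose interior lies in `C` and the given path. -/
theorem exists_path_of_adj {L : ℕ} {S : Set V} : ∀ (n : ℕ) (C : Finset V) (r x : V),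
    C.card ≤ n → Conn G C → r ∈ C → Has G (RTree.path L) S r →
      Anti G S (C.erase r : Finset V) → x ∉ C → Anti G S {x} → (∃ c ∈ C, G.Adj x c) →
      ∃ y ∈ C, ∃ S' : Set V, S' ⊆ S ∪ C ∧ G.Adj x y ∧ Anti G {x} S' ∧ Has G (RTree.path L) S' y
  | 0, C, r, x, hn, _, hr, _, _, _, _, _ => by
    simp only [Nat.le_zero, Finset.card_eq_zero] at hn
    simp [hn] at hr
  | n + 1, C, r, x, hn, hC, hr, hhas, hanti, hx, hxS, ⟨c, hc, hxc⟩ => by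
    by_cases hxr : G.Adj x r
    · exact ⟨r, hr, S, Set.subset_union_left, hxr, hxS.symm, hhas⟩
    let W := C.filter fun v => ¬ G.Adj x v
    obtain ⟨D, hD, hrD, hconn⟩ := exists_conn_closedIn_mem (G := G) (W := W) (r := r)
      (Finset.mem_filter.2 ⟨hr, hxr⟩)
    have hDC : D ⊆ C := hD.1.trans (Finset.filter_subset _ _)
    have hDx : ∀ b ∈ D, ¬ G.Adj x b := fun b hb => (Finset.mem_filter.1 (hD.1 hb)).2
    have hcD : c ∉ D := fun h => hDx c h hxc
    obtain ⟨b, hb, a, ha, hba⟩ := hC D hDC ⟨r, hrD⟩ (fun e => hcD (e ▸ hc))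
    rw [Finset.mem_sdiff] at ha
    have hxa : G.Adj x a := by
      by_contra hxa
      exact ha.2 (hD.2 b hb a (Finset.mem_filter.2 ⟨ha.1, hxa⟩) hba)
    have har : a ≠ r := fun e => ha.2 (e ▸ hrD)
    have hlt : D.card < C.card := Finset.card_lt_card ⟨hDC, fun h => hcD (h hc)⟩
    obtain ⟨y, hy, S', hS', hay, haS', hhas'⟩ := exists_path_of_adj n D r a (by omega) hconn hrD
      hhas (hanti.mono subset_rfl (Finset.coe_subset.2 (Finset.erase_subset_erase r hDC))) ha.2
      (hanti.mono subset_rfl (by simp [har, ha.1])) ⟨b, hb, hba.symm⟩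
    refine ⟨a, ha.1, S' ∪ {y}, ?_, hxa, ?_, ?_⟩
    · refine Set.union_subset (hS'.trans (Set.union_subset_union_right S
        (Finset.coe_subset.2 hDC))) ?_
      rintro _ rfl
      exact .inr (hDC hy)
    · have hxD : Anti G {x} (D : Set V) := by
        rintro _ rfl b hb
        exact ⟨fun e => hx (e ▸ hDC hb), hDx b hb⟩
      exact ((hxS.symm.union_right hxD).mono subset_rfl hS').union_right
        (hxD.mono subset_rfl (by simpa using hy))
    · refine Has.of_le (RTree.path_le_path_succ L) ?_
      exact ⟨∅, S', y, by simp, by simp, by simp, hay, trivial, hhas', haS', by simp [Anti],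
        by simp [Anti]⟩

end Connected

/-! ### Merging caterpillars in a coherent graph -/

section Merging

open scoped Classical

variable {V : Type*} {G : SimpleGraph V} {E : ℕ} {ι : Type*}

/-- A system of rooted trees with many candidates for each root: the sets `X i` of candidates are
disjoint and have at least `s` members, each member of `X i` is the root of a copy of `T i` whose
other vertices are in `S i`, and `S i` has no contact with the sets that belong to `j ≠ i`. -/
structure Pool (G : SimpleGraph V) (I : Finset ι) (X : ι → Finset V) (S : ι → Set V)
    (T : ι → RTree) (s : ℕ) : Prop where
  le_card : ∀ i ∈ I, s ≤ (X i).card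
  disj : ∀ i ∈ I, ∀ j ∈ I, i ≠ j → Disjoint (X i) (X j)
  antiX : ∀ i ∈ I, ∀ j ∈ I, i ≠ j → Anti G (S i) (X j)
  antiS : ∀ i ∈ I, ∀ j ∈ I, i ≠ j → Anti G (S i) (S j)
  has : ∀ i ∈ I, ∀ x ∈ X i, Has G (T i) (S i) x

/-- The vertices of `X` that have a neighbour in `Y`. -/
noncomputable def covered (G : SimpleGraph V) (Y X : Finset V) : Finset V :=
  X.filter fun x => ∃ y ∈ Y, G.Adj x y

theorem covered_subset (Y X : Finset V) : covered G Y X ⊆ X := Finset.filter_subset _ _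

theorem covered_insert_card (hG : Coherent G E) (v : V) (Y X : Finset V) :
    (covered G (insert v Y) X).card ≤ (covered G Y X).card + E := by
  have : covered G (insert v Y) X ⊆ covered G Y X ∪ X.filter (G.Adj v) := by
    intro x hx
    simp only [covered, Finset.mem_filter, Finset.mem_insert, Finset.mem_union] at hx ⊢
    obtain ⟨hxX, y, rfl | hy, hxy⟩ := hx
    · exact .inr ⟨hxX, hxy.symm⟩
    · exact .inl ⟨hxX, y, hy, hxy⟩
  have h1 := Finset.card_le_card this
  have h2 := Finset.card_union_le (covered G Y X) (X.filter (G.Adj v))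
  have h3 := hG.degree_lt v X
  omega

theorem covered_card_le (hG : Coherent G E) (Y X : Finset V) :
    (covered G Y X).card ≤ Y.card * E := by
  induction Y using Finset.induction_on with
  | empty => simp [covered]
  | insert v Y hv ih =>
    have := covered_insert_card hG v Y X
    rw [Finset.card_insert_of_notMem hv, Nat.add_mul]
    omega

theorem card_sdiff_covered (Y X : Finset V) :
    (X \ covered G Y X).card + (covered G Y X).card = X.card :=
  Finset.card_sdiff_add_card_eq_card (covered_subset Y X)

/-- Let `A` be a large set, and let a subset of `A` be grown vertex by vertex. Stopped when it first
covers half of one of the sets `X j`, it leaves almost half of each other set uncovered. -/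
theorem Coherent.exists_half_cover (hG : Coherent G E) {A : Finset V} (hA : E ≤ A.card)
    {P : Finset V → Prop} {C₀ : Finset V} (hC₀ : P C₀) (hC₀A : C₀ ⊆ A) (hC₀c : C₀.card ≤ 1)
    (hP : ∀ C, P C → C ⊆ A → C₀ ⊆ C → C ≠ A → ∃ v ∈ A, v ∉ C ∧ P (insert v C)) {J : Finset ι}
    {X : ι → Finset V} (hJ : J.Nonempty) (hX : ∀ j ∈ J, 2 * E < (X j).card)
    (hAX : ∀ j ∈ J, Disjoint A (X j)) :
    ∃ Y ⊆ A, P Y ∧ ∃ j ∈ J, (X j).card ≤ 2 * (covered G Y (X j)).card ∧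
      ∀ l ∈ J, l ≠ j → (X l).card ≤ 2 * (X l \ covered G Y (X l)).card + 2 * E := by
  obtain ⟨⟨C, hCA⟩, -, ⟨hPC, hC₀C, hC⟩, hmax⟩ := Finite.exists_le_maximal
    (a := (⟨C₀, Finset.mem_powerset.2 hC₀A⟩ : A.powerset))
    (p := fun C : A.powerset => P C.1 ∧ C₀ ⊆ C.1 ∧
      ∀ j ∈ J, 2 * (covered G C.1 (X j)).card < (X j).card)
    ⟨hC₀, subset_rfl, fun j hj => by
      have h1 := covered_card_le hG C₀ (X j)
      have h2 := hX j hj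
      have h3 : C₀.card * E ≤ 1 * E := Nat.mul_le_mul_right E hC₀c
      dsimp only
      omega⟩
  dsimp only at hPC hC₀C hC
  rw [Finset.mem_powerset] at hCA
  have hne : C ≠ A := by
    rintro rfl
    obtain ⟨j, hj⟩ := hJ
    have h1 := hC j hj
    have h2 := hX j hj
    have h3 := card_sdiff_covered (G := G) C (X j)
    obtain ⟨a, ha, b, hb, hab⟩ := hG.exists_adj C (X j \ covered G C (X j))
      ((hAX j hj).mono_right Finset.sdiff_subset) hA (by omega)
    rw [Finset.mem_sdiff] at hb
    exact hb.2 (Finset.mem_filter.2 ⟨hb.1, a, ha, hab.symm⟩)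
  obtain ⟨v, hvA, hvC, hPv⟩ := hP C hPC hCA hC₀C hne
  have hins : insert v C ⊆ A := Finset.insert_subset hvA hCA
  refine ⟨insert v C, hins, hPv, ?_⟩
  by_contra! hcon
  refine hvC (hmax (y := ⟨insert v C, Finset.mem_powerset.2 hins⟩) ⟨hPv,
    hC₀C.trans (Finset.subset_insert v C), fun j hj => ?_⟩ (Finset.subset_insert v C)
    (Finset.mem_insert_self v C))
  by_contra! hj'
  obtain ⟨l, hl, -, hlt⟩ := hcon j hj hj'
  have h1 := covered_insert_card hG v C (X l)
  have h2 := hC l hl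
  have h3 := card_sdiff_covered (G := G) (insert v C) (X l)
  omega

/-- The data `A`, `S₀`, `P`, `C` describe how the tree `C` grows out of `X i`: whenever `Y ⊆ A` has
property `P`, every outside vertex with a neighbour in `Y` has a neighbour that is the root of a
copy of `C` in `S₀ ∪ Y`. Then `C` can be hung below the root of one of the other trees, at the cost
of the index `i` and of somewhat more than half of every candidate set. -/
theorem Pool.move (hG : Coherent G E) {I : Finset ι} {X : ι → Finset V} {S : ι → Set V}
    {T : ι → RTree} {s s' : ℕ} (h : Pool G I X S T s) (hs : 2 * s' + 2 * E < s) {i : ι}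
    (hi : i ∈ I) (hI : (I.erase i).Nonempty) {A : Finset V} (hAX : A ⊆ X i) (hA : E ≤ A.card)
    {S₀ : Set V} (hS₀X : ∀ l ∈ I, l ≠ i → Anti G S₀ (X l))
    (hS₀S : ∀ l ∈ I, l ≠ i → Anti G S₀ (S l)) {C : RTree} {P : Finset V → Prop} {C₀ : Finset V}
    (hC₀ : P C₀) (hC₀A : C₀ ⊆ A) (hC₀c : C₀.card ≤ 1)
    (hP : ∀ Y, P Y → Y ⊆ A → C₀ ⊆ Y → Y ≠ A → ∃ v ∈ A, v ∉ Y ∧ P (insert v Y))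
    (hC : ∀ Y, P Y → Y ⊆ A → ∀ x, x ∉ Y → Anti G S₀ {x} → (∃ y ∈ Y, G.Adj x y) →
      ∃ y ∈ Y, ∃ S' : Set V, S' ⊆ S₀ ∪ Y ∧ G.Adj x y ∧ Anti G {x} S' ∧ Has G C S' y) :
    ∃ j ∈ I.erase i, ∃ (X' : ι → Finset V) (S' : ι → Set V),
      Pool G (I.erase i) X' S' (Function.update T j (.join (T j) C)) s' := by
  have hmem : ∀ l ∈ I.erase i, l ∈ I ∧ l ≠ i := fun l hl =>
    ⟨Finset.mem_of_mem_erase hl, Finset.ne_of_mem_erase hl⟩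
  have hdisj : ∀ l ∈ I.erase i, Disjoint A (X l) := fun l hl =>
    (h.disj i hi l (hmem l hl).1 (hmem l hl).2.symm).mono_left hAX
  obtain ⟨Y, hYA, hPY, j, hj, hcov, hunc⟩ := hG.exists_half_cover hA hC₀ hC₀A hC₀c hP hI
    (fun l hl => by have := h.le_card l (hmem l hl).1; omega) hdisj
  have hjI := (hmem j hj).1
  have hji := (hmem j hj).2
  let X' : ι → Finset V := fun l => if l = j then covered G Y (X j) else X l \ covered G Y (X l)
  let S' : ι → Set V := Function.update S j (S j ∪ (S₀ ∪ Y))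
  have hX'j : X' j = covered G Y (X j) := if_pos rfl
  have hX'ne : ∀ l, l ≠ j → X' l = X l \ covered G Y (X l) := fun l hl => if_neg hl
  have hS'j : S' j = S j ∪ (S₀ ∪ Y) := Function.update_self ..
  have hS'ne : ∀ l, l ≠ j → S' l = S l := fun l hl => Function.update_of_ne hl _ _
  have hX' : ∀ l, X' l ⊆ X l := by
    intro l
    by_cases hl : l = j
    · rw [hl, hX'j]
      exact covered_subset _ _
    · rw [hX'ne l hl]
      exact Finset.sdiff_subset
  have hYS : ∀ l ∈ I, l ≠ i → Anti G (Y : Set V) (S l) := fun l hl hli =>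
    ((h.antiX l hl i hi hli).mono subset_rfl (Finset.coe_subset.2 (hYA.trans hAX))).symm
  have hnew : ∀ l ∈ I, l ≠ i → l ≠ j → Anti G (S' j) (S l) := fun l hl hli hlj => by
    rw [hS'j]
    exact (h.antiS j hjI l hl hlj.symm).union_left ((hS₀S l hl hli).union_left (hYS l hl hli))
  refine ⟨j, hj, X', S', ?_, ?_, ?_, ?_, ?_⟩
  · intro l hl
    have := h.le_card l (hmem l hl).1
    by_cases hlj : l = j
    · subst hlj
      rw [hX'j]
      omega
    · have := hunc l hl hlj
      rw [hX'ne l hlj]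
      omega
  · intro a ha b hb hab
    exact (h.disj a (hmem a ha).1 b (hmem b hb).1 hab).mono (hX' a) (hX' b)
  · intro a ha b hb hab
    obtain ⟨haI, hai⟩ := hmem a ha
    obtain ⟨hbI, hbi⟩ := hmem b hb
    by_cases haj : a = j
    · subst haj
      rw [hS'j]
      refine ((h.antiX a haI b hbI hab).mono subset_rfl (Finset.coe_subset.2 (hX' b))).union_left
        (((hS₀X b hbI hbi).mono subset_rfl (Finset.coe_subset.2 (hX' b))).union_left ?_)
      intro y hy x hx
      rw [hX'ne b hab.symm, Finset.mem_coe, Finset.mem_sdiff] at hx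
      refine ⟨fun e => ?_, fun e => hx.2 (Finset.mem_filter.2 ⟨hx.1, y, hy, e.symm⟩)⟩
      exact Finset.disjoint_left.1 (hdisj b hb) (hYA hy) (e ▸ hx.1)
    · rw [hS'ne a haj]
      exact (h.antiX a haI b hbI hab).mono subset_rfl (Finset.coe_subset.2 (hX' b))
  · intro a ha b hb hab
    obtain ⟨haI, hai⟩ := hmem a ha
    obtain ⟨hbI, hbi⟩ := hmem b hb
    by_cases haj : a = j
    · subst haj
      rw [hS'ne b hab.symm]
      exact hnew b hbI hbi hab.symm
    · rw [hS'ne a haj]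
      by_cases hbj : b = j
      · subst hbj
        exact (hnew a haI hai hab).symm
      · rw [hS'ne b hbj]
        exact h.antiS a haI b hbI hab
  · intro l hl x hx
    have hxX := hX' l hx
    obtain ⟨hlI, hli⟩ := hmem l hl
    by_cases hlj : l = j
    · subst hlj
      rw [Function.update_self, hS'j]
      rw [hX'j] at hx
      have hxY : x ∉ Y := fun hxY => Finset.disjoint_left.1 (hdisj l hl) (hYA hxY) hxX
      obtain ⟨y, hy, U, hU, hxy, hxU, hhas⟩ := hC Y hPY hYA x hxY
        ((hS₀X l hlI hli).mono subset_rfl (by simpa using hxX)) (Finset.mem_filter.1 hx).2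
      have hlY := (hYS l hlI hli).symm
      refine ⟨S l, U, y, Set.subset_union_left, hU.trans Set.subset_union_right,
        .inr (.inr hy), hxy, h.has l hlI x hxX, hhas, hxU,
        hlY.mono subset_rfl (by simpa using hy), ?_⟩
      exact ((hS₀S l hlI hli).symm.union_right hlY).mono subset_rfl hU
    · rw [Function.update_of_ne hlj, hS'ne l hlj]
      exact h.has l hlI x hxX

/-- The tree at `i` is hung below the root of another tree. -/
theorem Pool.move_tree (hG : Coherent G E) {I : Finset ι} {X : ι → Finset V} {S : ι → Set V}
    {T : ι → RTree} {s s' : ℕ} (h : Pool G I X S T s) (hs : 2 * s' + 2 * E < s) {i : ι}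
    (hi : i ∈ I) (hI : (I.erase i).Nonempty) :
    ∃ j ∈ I.erase i, ∃ (X' : ι → Finset V) (S' : ι → Set V),
      Pool G (I.erase i) X' S' (Function.update T j (.join (T j) (T i))) s' := by
  refine h.move hG hs hi hI (A := X i) subset_rfl (by have := h.le_card i hi; omega) (S₀ := S i)
    (fun l hl hli => h.antiX i hi l hl hli.symm) (fun l hl hli => h.antiS i hi l hl hli.symm)
    (P := fun _ => True) (C₀ := ∅) trivial (by simp) (by simp) ?_ ?_
  · intro Y _ hY _ hne
    obtain ⟨v, hv, hvY⟩ := Finset.exists_of_ssubset (hY.ssubset_of_ne hne)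
    exact ⟨v, hv, hvY, trivial⟩
  · rintro Y - hY x - hxS ⟨y, hy, hxy⟩
    exact ⟨y, hy, S i, Set.subset_union_left, hxy, hxS.symm, h.has i hi y (hY hy)⟩

/-- The tree at `i` is given up, and a long path found among its candidates is hung below the root
of another tree. -/
theorem Pool.move_path (hG : Coherent G E) (hE : 0 < E) {I : Finset ι} {X : ι → Finset V}
    {S : ι → Set V} {T : ι → RTree} {s s' : ℕ} (h : Pool G I X S T s) (L : ℕ)
    (hs : 2 * s' + (2 * L + 4) * E < s) {i : ι} (hi : i ∈ I) (hI : (I.erase i).Nonempty) :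
    ∃ j ∈ I.erase i, ∃ (X' : ι → Finset V) (S' : ι → Set V),
      Pool G (I.erase i) X' S' (Function.update T j (.join (T j) (.path L))) s' := by
  have hsi := h.le_card i hi
  obtain ⟨A, S₀, r, hAX, hSX, hSc, hA, hr, hAc, hhas, hanti⟩ :=
    hG.exists_path hE (X := X i) L (by omega)
  have e : (2 * L + 4) * E = (2 * L + 1) * E + 3 * E := by ring
  have e' : (2 * L + 4) * E = L * E + 2 * E + (L + 2) * E := by ring
  -- the other candidate sets lose the few vertices with a neighbour on the path
  let X₁ : ι → Finset V := fun l => if l = i then X i else X l \ covered G S₀ (X l)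
  have hX₁i : X₁ i = X i := if_pos rfl
  have hX₁ne : ∀ l, l ≠ i → X₁ l = X l \ covered G S₀ (X l) := fun l hl => if_neg hl
  have hX₁ : ∀ l, X₁ l ⊆ X l := by
    intro l
    by_cases hl : l = i
    · rw [hl, hX₁i]
    · rw [hX₁ne l hl]
      exact Finset.sdiff_subset
  have h₁ : Pool G I X₁ S T (s - L * E) := by
    refine ⟨?_, ?_, ?_, h.antiS, fun l hl x hx => h.has l hl x (hX₁ l hx)⟩
    · intro l hl
      have h1 := h.le_card l hl
      by_cases hli : l = i
      · rw [hli, hX₁i]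
        omega
      · have h2 := card_sdiff_covered (G := G) S₀ (X l)
        have h3 := covered_card_le hG S₀ (X l)
        have h4 := Nat.mul_le_mul_right E hSc
        rw [hX₁ne l hli]
        omega
    · exact fun a ha b hb hab => (h.disj a ha b hb hab).mono (hX₁ a) (hX₁ b)
    · exact fun a ha b hb hab =>
        (h.antiX a ha b hb hab).mono subset_rfl (Finset.coe_subset.2 (hX₁ b))
  refine h₁.move hG (by omega) hi hI (A := A) (by rwa [hX₁i]) (by omega) (S₀ := S₀) ?_ ?_
    (P := fun Y => Conn G Y ∧ r ∈ Y) (C₀ := {r}) ⟨Conn.singleton r, by simp⟩ (by simpa using hr)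
    (by simp) ?_ ?_
  · intro l hl hli y hy x hx
    rw [hX₁ne l hli, Finset.mem_coe, Finset.mem_sdiff] at hx
    refine ⟨fun e => ?_, fun e => hx.2 (Finset.mem_filter.2 ⟨hx.1, y, hy, e.symm⟩)⟩
    exact Finset.disjoint_left.1 (h.disj i hi l hl hli.symm) (hSX hy) (e ▸ hx.1)
  · intro l hl hli
    exact ((h.antiX l hl i hi hli).mono subset_rfl (Finset.coe_subset.2 hSX)).symm
  · rintro Y ⟨hY, hrY⟩ hYA - hne
    obtain ⟨b, hb, a, ha, hba⟩ := hA Y hYA ⟨r, hrY⟩ hne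
    rw [Finset.mem_sdiff] at ha
    exact ⟨a, ha.1, ha.2, hY.insert ⟨b, hb, hba⟩, Finset.mem_insert_of_mem hrY⟩
  · rintro Y ⟨hY, hrY⟩ hYA x hx hxS hxY
    exact exists_path_of_adj Y.card Y r x le_rfl hY hrY hhas
      (hanti.mono subset_rfl (Finset.coe_subset.2 (Finset.erase_subset_erase r hYA))) hx hxS hxY

theorem Pool.of_le {I : Finset ι} {X : ι → Finset V} {S : ι → Set V} {T T' : ι → RTree} {s : ℕ}
    (h : Pool G I X S T s) (hT : ∀ i ∈ I, (T' i).Le (T i)) : Pool G I X S T' s :=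
  ⟨h.le_card, h.disj, h.antiX, h.antiS, fun i hi x hx => (h.has i hi x hx).of_le (hT i hi)⟩

/-- The root of `cat d L n` has all its `d` legs. -/
def Full (d n : ℕ) : Prop := (d + 1) ∣ (n + 1)

theorem sum_update_le {I : Finset ι} {f : ι → ℕ} {i j : ι} (hi : i ∈ I) (hj : j ∈ I.erase i)
    {m : ℕ} (him : f i + 1 ≤ m) (hjm : f j + 1 ≤ m) :
    ∑ l ∈ I, 2 ^ f l ≤ ∑ l ∈ I.erase i, 2 ^ (Function.update f j m) l := by
  rw [← Finset.add_sum_erase I _ hi, ← Finset.add_sum_erase (I.erase i) _ hj,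
    ← Finset.add_sum_erase (I.erase i) (fun l => 2 ^ (Function.update f j m) l) hj]
  have h1 : ∑ l ∈ (I.erase i).erase j, 2 ^ (Function.update f j m) l =
      ∑ l ∈ (I.erase i).erase j, 2 ^ f l := Finset.sum_congr rfl fun l hl => by
    rw [Function.update_of_ne (Finset.ne_of_mem_erase hl)]
  have h2 : 2 ^ f i * 2 ≤ 2 ^ m := by
    rw [← pow_succ]
    exact Nat.pow_le_pow_right (by omega) him
  have h3 : 2 ^ f j * 2 ≤ 2 ^ m := by
    rw [← pow_succ]
    exact Nat.pow_le_pow_right (by omega) hjm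
  rw [h1, Function.update_self]
  omega

/-- One move that turns two caterpillars into a single one whose index exceeds both of theirs. If
the root of some tree is full, that tree is moved: it becomes the child of a root above it or, if
the receiving tree has the larger index, a leg there. If no root is full, the tree of least index
is traded for a leg. -/
theorem Pool.exists_merge (hG : Coherent G E) (hE : 0 < E) {d L : ℕ} (hd : 1 ≤ d) {I : Finset ι}
    {X : ι → Finset V} {S : ι → Set V} {f : ι → ℕ} {s s' : ℕ}
    (h : Pool G I X S (fun i => RTree.cat d L (f i)) s) (hs : 2 * s' + (2 * L + 4) * E < s)
    (hI : 1 < I.card) (hfull : ∀ i ∈ I, ∀ j ∈ I, Full d (f i) → Full d (f j) → i = j) :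
    ∃ i ∈ I, ∃ j ∈ I.erase i, ∃ (m : ℕ) (X' : ι → Finset V) (S' : ι → Set V), f i + 1 ≤ m ∧
      f j + 1 ≤ m ∧ (∀ l ∈ I.erase i, ¬ Full d (f l)) ∧
      Pool G (I.erase i) X' S' (fun l => RTree.cat d L (Function.update f j m l)) s' := by
  have hne : ∀ i ∈ I, (I.erase i).Nonempty := fun i hi => by
    rw [← Finset.card_pos, Finset.card_erase_of_mem hi]
    omega
  have conclude : ∀ {i j : ι} {C : RTree} {m : ℕ} {X' : ι → Finset V} {S' : ι → Set V},
      (RTree.cat d L m).Le (.join (RTree.cat d L (f j)) C) →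
      Pool G (I.erase i) X' S' (Function.update (fun i => RTree.cat d L (f i)) j
        (.join (RTree.cat d L (f j)) C)) s' →
      Pool G (I.erase i) X' S' (fun l => RTree.cat d L (Function.update f j m l)) s' := by
    intro i j C m X' S' hle hp
    refine hp.of_le fun l _ => ?_
    by_cases hlj : l = j
    · subst hlj
      simpa using hle
    · simpa [Function.update_of_ne hlj] using RTree.Le.rfl
  by_cases hex : ∃ i ∈ I, Full d (f i)
  · obtain ⟨i, hi, hif⟩ := hex
    have hnf : ∀ l ∈ I.erase i, ¬ Full d (f l) := fun l hl hlf =>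
      Finset.ne_of_mem_erase hl (hfull l (Finset.mem_of_mem_erase hl) i hi hlf hif)
    have h2 : 2 * E ≤ (2 * L + 4) * E := Nat.mul_le_mul_right E (by omega)
    obtain ⟨j, hj, X', S', hp⟩ := h.move_tree hG (s' := s') (by omega) hi (hne i hi)
    have hnj : ¬ (d + 1) ∣ f j + 1 := hnf j hj
    have hne' : f j ≠ f i := fun e => hnf j hj (e ▸ hif)
    rcases lt_or_gt_of_ne hne' with hlt | hlt
    · refine ⟨i, hi, j, hj, f i + 1, X', S', le_rfl, by omega, hnf, conclude ?_ hp⟩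
      rw [RTree.cat, if_pos (show (d + 1) ∣ f i + 1 from hif)]
      exact .join (.pt _) .rfl
    · refine ⟨i, hi, j, hj, f j + 1, X', S', by omega, le_rfl, hnf, conclude ?_ hp⟩
      rw [RTree.cat, if_neg hnj]
      obtain ⟨n, hn⟩ : ∃ n, f i = n + 1 := Nat.exists_eq_succ_of_ne_zero fun e => by
        rw [e] at hif
        have := Nat.le_of_dvd (by omega) hif
        omega
      refine .join .rfl ?_
      rw [hn]
      exact RTree.path_le_cat hd n
  · push Not at hex
    obtain ⟨i, hi, hmin⟩ := I.exists_min_image f (Finset.card_pos.1 (by omega))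
    obtain ⟨j, hj, X', S', hp⟩ := h.move_path hG hE L hs hi (hne i hi)
    have hjI := Finset.mem_of_mem_erase hj
    have hnj : ¬ (d + 1) ∣ f j + 1 := hex j hjI
    refine ⟨i, hi, j, hj, f j + 1, X', S', by have := hmin j hjI; omega, le_rfl,
      fun l hl => hex l (Finset.mem_of_mem_erase hl), conclude ?_ hp⟩
    rw [RTree.cat, if_neg hnj]
    exact .rfl

theorem Pool.exists_has (hG : Coherent G E) (hE : 0 < E) {d L : ℕ} (hd : 1 ≤ d) : ∀ (M : ℕ)
    {I : Finset ι} {X : ι → Finset V} {S : ι → Set V} {f : ι → ℕ}, I.card = M + 1 →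
    Pool G I X S (fun i => RTree.cat d L (f i)) (4 ^ M * ((2 * L + 5) * E)) →
    (∀ i ∈ I, ∀ j ∈ I, Full d (f i) → Full d (f j) → i = j) →
    ∃ n x S', ∑ i ∈ I, 2 ^ f i ≤ 2 ^ n ∧ Has G (RTree.cat d L n) S' x
  | 0, I, X, S, f, hI, h, _ => by
    obtain ⟨i, rfl⟩ := Finset.card_eq_one.1 (by simpa using hI)
    have hc := h.le_card i (by simp)
    have hpos : 0 < (2 * L + 5) * E := by positivity
    obtain ⟨x, hx⟩ : (X i).Nonempty := Finset.card_pos.1 (by omega)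
    exact ⟨f i, x, S i, by simp, h.has i (by simp) x hx⟩
  | M + 1, I, X, S, f, hI, h, hfull => by
    have hs : 2 * (4 ^ M * ((2 * L + 5) * E)) + (2 * L + 4) * E <
        4 ^ (M + 1) * ((2 * L + 5) * E) := by
      have h1 : 1 * ((2 * L + 5) * E) ≤ 4 ^ M * ((2 * L + 5) * E) :=
        Nat.mul_le_mul_right _ (Nat.one_le_pow _ _ (by omega))
      have h2 : (2 * L + 5) * E = (2 * L + 4) * E + E := by ring
      have h3 : 4 ^ (M + 1) * ((2 * L + 5) * E) = 4 * (4 ^ M * ((2 * L + 5) * E)) := by ring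
      omega
    obtain ⟨i, hi, j, hj, m, X', S', him, hjm, hnf, hp⟩ :=
      h.exists_merge hG hE hd hs (by omega) hfull
    obtain ⟨n, x, S'', hsum, hhas⟩ := Pool.exists_has hG hE hd M
      (by rw [Finset.card_erase_of_mem hi]; omega) hp (by
        -- only the tree at `j` has changed, and no other one is full
        have hj' : ∀ l ∈ I.erase i, Full d (Function.update f j m l) → l = j := by
          intro l hl hlf
          by_contra hlj
          rw [Function.update_of_ne hlj] at hlf
          exact hnf l hl hlf
        exact fun a ha b hb haf hbf => (hj' a ha haf).trans (hj' b hb hbf).symm)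
    exact ⟨n, x, S'', (sum_update_le hi hj him hjm).trans hsum, hhas⟩

/-- Starting from single vertices with disjoint candidate sets, merging reaches `cat d L n` for an
arbitrarily large `n`. -/
theorem Coherent.exists_has [Fintype V] (hG : Coherent G E) (hE : 0 < E) {d L : ℕ} (hd : 1 ≤ d)
    (n₀ : ℕ) (hV : 2 ^ n₀ * 4 ^ (2 ^ n₀) * (2 * L + 5) * E ≤ Fintype.card V) :
    ∃ n x S, n₀ ≤ n ∧ Has G (RTree.cat d L n) S x := by
  obtain ⟨M, hM⟩ : ∃ M, 2 ^ n₀ = M + 1 := Nat.exists_eq_succ_of_ne_zero (by positivity)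
  rw [hM] at hV
  let s := 4 ^ M * ((2 * L + 5) * E)
  obtain ⟨g⟩ : Nonempty (Fin (M + 1) × Fin s ↪ V) := by
    refine Function.Embedding.nonempty_of_card_le ?_
    rw [Fintype.card_prod, Fintype.card_fin, Fintype.card_fin]
    refine le_trans ?_ hV
    calc (M + 1) * s = (M + 1) * 4 ^ M * (2 * L + 5) * E := by ring
      _ ≤ _ := by gcongr <;> omega
  have hnf : ¬ Full d 0 := fun h => by
    have := Nat.le_of_dvd (by omega) h
    omega
  obtain ⟨n, x, S, hsum, hhas⟩ := Pool.exists_has hG hE (L := L) hd M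
    (I := (Finset.univ : Finset (Fin (M + 1)))) (f := fun _ => 0) (S := fun _ => ∅)
    (X := fun i => Finset.univ.map ⟨fun t => g (i, t), fun a b e => by simpa using g.injective e⟩)
    (by simp) ⟨by simp [s], fun i _ j _ hij => by
      rw [Finset.disjoint_left]
      rintro x hx hx'
      simp only [Finset.mem_map, Finset.mem_univ, true_and] at hx hx'
      obtain ⟨a, rfl⟩ := hx
      obtain ⟨b, hb⟩ := hx'
      have := g.injective hb
      simp only [Prod.mk.injEq] at this
      exact hij this.1.symm, by simp [Anti], by simp [Anti], fun _ _ _ _ => trivial⟩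
    (fun _ _ _ _ h => (hnf h).elim)
  refine ⟨n, x, S, ?_, hhas⟩
  rw [Finset.sum_const, Finset.card_univ, Fintype.card_fin, ← hM] at hsum
  exact (Nat.pow_le_pow_iff_right (a := 2) (by omega)).1 (by simpa using hsum)

end Merging

/-! ### Sparse sets and Rödl's theorem -/

section Rodl

open scoped Classical

universe u v

variable {V : Type u} {G : SimpleGraph V}

/-- Each vertex of `A` has at most `B.card / h` neighbours in `B`. -/
def SparseTo (G : SimpleGraph V) (h : ℕ) (A B : Finset V) : Prop :=
  ∀ a ∈ A, h * (B.filter (G.Adj a)).card ≤ B.card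

/-- If the vertices of `A` have few neighbours in `B`, then at least half of the vertices of `B`
have few neighbours in `A`. -/
theorem SparseTo.card_le {h : ℕ} {A B : Finset V} (hAB : SparseTo G (2 * h) A B) :
    B.card ≤ 2 * (B.filter fun b => h * (A.filter (G.Adj b)).card ≤ A.card).card := by
  have hsplit := Finset.card_filter_add_card_filter_not (s := B)
    (fun b => h * (A.filter (G.Adj b)).card ≤ A.card)
  set D := B.filter fun b => ¬ h * (A.filter (G.Adj b)).card ≤ A.card with hD
  suffices 2 * D.card ≤ B.card by omega
  rcases A.eq_empty_or_nonempty with rfl | hA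
  · simp [hD]
  have hswap : ∑ a ∈ A, (B.filter (G.Adj a)).card = ∑ b ∈ B, (A.filter (G.Adj b)).card := by
    have := Finset.sum_card_bipartiteAbove_eq_sum_card_bipartiteBelow (s := A) (t := B) G.Adj
    simpa [Finset.bipartiteAbove, Finset.bipartiteBelow, G.adj_comm] using this
  have h1 : D.card * A.card ≤ ∑ b ∈ B, h * (A.filter (G.Adj b)).card := by
    rw [← smul_eq_mul]
    refine (Finset.card_nsmul_le_sum D (fun b => h * (A.filter (G.Adj b)).card) _
      fun b hb => ?_).trans (Finset.sum_le_sum_of_subset (Finset.filter_subset _ _))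
    exact (not_le.1 (Finset.mem_filter.1 hb).2).le
  have h2 : ∑ a ∈ A, 2 * h * (B.filter (G.Adj a)).card ≤ A.card * B.card := by
    rw [← smul_eq_mul]
    exact Finset.sum_le_card_nsmul A _ _ hAB
  rw [← Finset.mul_sum, ← hswap] at h1
  rw [← Finset.mul_sum, mul_assoc] at h2
  refine Nat.le_of_mul_le_mul_left ?_ hA.card_pos
  calc A.card * (2 * D.card) = 2 * (D.card * A.card) := by ring
    _ ≤ 2 * (h * ∑ a ∈ A, (B.filter (G.Adj a)).card) := Nat.mul_le_mul_left 2 h1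
    _ ≤ A.card * B.card := h2

/-- Greedy embedding: the vertices of `U` are embedded one by one, the image of `u` being chosen
in `X u`, and each choice shrinks the remaining sets `X w` to the vertices that are still eligible.
If this gets stuck, there is a large pair of sets which is sparse in `G` or in its complement. -/
theorem exists_embedding_or_sparseTo {W : Type v} [Nonempty V] (H : SimpleGraph W) {h k s : ℕ}
    (hh : 0 < h) (W₀ : Finset V) : ∀ (n : ℕ), n ≤ k → ∀ (U : Finset W) (X : W → Finset V), U.card = n →
      (∀ u ∈ U, X u ⊆ W₀) → (∀ u ∈ U, ∀ v ∈ U, u ≠ v → Disjoint (X u) (X v)) →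
      (∀ u ∈ U, (h * k) ^ n * s < (X u).card) →
      (∃ f : W → V, (∀ u ∈ U, f u ∈ X u) ∧
        ∀ u ∈ U, ∀ v ∈ U, (G.Adj (f u) (f v) ↔ H.Adj u v)) ∨
      ∃ A ⊆ W₀, ∃ B ⊆ W₀, Disjoint A B ∧ s ≤ A.card ∧ s ≤ B.card ∧
        (SparseTo G h A B ∨ SparseTo Gᶜ h A B)
  | 0, _, U, X, hU, hXW, _, hX => by
    rw [Finset.card_eq_zero] at hU
    subst hU
    exact .inl ⟨fun _ => Classical.arbitrary V, by simp, by simp⟩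
  | n + 1, hn, U, X, hU, hXW, hdisj, hX => by
    obtain ⟨u₀, U', hu₀, rfl, hU'⟩ := Finset.card_eq_succ.1 hU
    have hu₀U : u₀ ∈ insert u₀ U' := Finset.mem_insert_self _ _
    have hUU : ∀ w ∈ U', w ∈ insert u₀ U' := fun w hw => Finset.mem_insert_of_mem hw
    have hne : ∀ w ∈ U', u₀ ≠ w := fun w hw e => hu₀ (e ▸ hw)
    let F : W → SimpleGraph V := fun w => if H.Adj u₀ w then G else Gᶜ
    let bad : W → Finset V := fun w =>
      (X u₀).filter fun x => h * ((X w).filter ((F w).Adj x)).card ≤ (X w).card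
    have hpow : ∀ m, 1 ≤ (h * k) ^ m := fun m => Nat.one_le_pow _ _ (Nat.mul_pos hh (show 0 < k by omega))
    have hF : ∀ w, F w = G ∨ F w = Gᶜ := fun w => by
      by_cases hw : H.Adj u₀ w
      · exact .inl (if_pos hw)
      · exact .inr (if_neg hw)
    by_cases hgood : ∃ x ∈ X u₀, ∀ w ∈ U', x ∉ bad w
    · obtain ⟨x, hx, hxgood⟩ := hgood
      have hxne : ∀ w ∈ U', ∀ y ∈ X w, x ≠ y := fun w hw y hy e =>
        Finset.disjoint_left.1 (hdisj u₀ hu₀U w (hUU w hw) (hne w hw)) hx (e ▸ hy)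
      rcases exists_embedding_or_sparseTo (k := k) (s := s) H hh W₀ n (by omega) U'
        (fun w => (X w).filter ((F w).Adj x)) hU'
        (fun w hw => (Finset.filter_subset _ _).trans (hXW w (hUU w hw)))
        (fun v hv w hw hvw => (hdisj v (hUU v hv) w (hUU w hw) hvw).mono
          (Finset.filter_subset _ _) (Finset.filter_subset _ _)) (fun w hw => by
            have h1 : (X w).card < h * ((X w).filter ((F w).Adj x)).card := by
              have := hxgood w hw
              simp only [bad, Finset.mem_filter, not_and, not_le] at this
              exact this hx
            have h2 := (hX w (hUU w hw)).trans h1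
            rw [show (h * k) ^ (n + 1) * s = h * (k * ((h * k) ^ n * s)) by ring] at h2
            have h3 := Nat.lt_of_mul_lt_mul_left h2
            have h4 : 1 * ((h * k) ^ n * s) ≤ k * ((h * k) ^ n * s) :=
              Nat.mul_le_mul_right _ (by omega)
            omega) with ⟨f, hfX, hf⟩ | hpair
      · have key : ∀ w ∈ U', (G.Adj x (f w) ↔ H.Adj u₀ w) := by
          intro w hw
          have h1 := Finset.mem_filter.1 (hfX w hw)
          have h2 := hxne w hw _ h1.1
          by_cases hadj : H.Adj u₀ w
          · simpa [F, hadj] using h1.2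
          · have h3 := h1.2
            simp only [F, hadj, if_false, SimpleGraph.compl_adj] at h3
            simp [hadj, h3.2]
        have hfne : ∀ w ∈ U', Function.update f u₀ x w = f w := fun w hw =>
          Function.update_of_ne (hne w hw).symm _ _
        refine .inl ⟨Function.update f u₀ x, ?_, ?_⟩
        · intro w hw
          rcases Finset.mem_insert.1 hw with rfl | hw
          · simpa using hx
          · rw [hfne w hw]
            exact (Finset.mem_filter.1 (hfX w hw)).1
        · intro v hv w hw
          rcases Finset.mem_insert.1 hv with hv | hv' <;>
            rcases Finset.mem_insert.1 hw with hw | hw'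
          · simp [hv, hw]
          · simpa [hv, hfne w hw'] using key w hw'
          · simpa [hw, hfne v hv', SimpleGraph.adj_comm] using key v hv'
          · simpa [hfne v hv', hfne w hw'] using hf v hv' w hw'
      · exact .inr hpair
    · push Not at hgood
      -- some vertex `w` is an obstacle for many of the candidates in `X u₀`
      have hbig : ∃ w ∈ U', s ≤ (bad w).card := by
        by_contra! hsmall
        have h1 : (X u₀).card ≤ ∑ w ∈ U', (bad w).card := by
          refine (Finset.card_le_card fun x hx => ?_).trans Finset.card_biUnion_le
          obtain ⟨w, hw, hxw⟩ := hgood x hx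
          exact Finset.mem_biUnion.2 ⟨w, hw, hxw⟩
        have h2 : ∑ w ∈ U', (bad w).card ≤ n * s := by
          rw [← hU', ← smul_eq_mul]
          exact Finset.sum_le_card_nsmul _ _ _ fun w hw => (hsmall w hw).le
        have h3 := hX u₀ hu₀U
        have h4 : n * s ≤ (h * k) ^ (n + 1) * s := by
          refine Nat.mul_le_mul_right s ?_
          calc n ≤ k := by omega
            _ ≤ h * k := Nat.le_mul_of_pos_left k hh
            _ = 1 * (h * k) := (one_mul _).symm
            _ ≤ (h * k) ^ n * (h * k) := Nat.mul_le_mul_right _ (hpow n)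
            _ = (h * k) ^ (n + 1) := (pow_succ _ _).symm
        omega
      obtain ⟨w, hw, hs⟩ := hbig
      have hXw : 1 * s ≤ (h * k) ^ (n + 1) * s := Nat.mul_le_mul_right s (hpow _)
      refine .inr ⟨bad w, (Finset.filter_subset _ _).trans (hXW u₀ hu₀U), X w, hXW w (hUU w hw),
        (hdisj u₀ hu₀U w (hUU w hw) (hne w hw)).mono_left (Finset.filter_subset _ _), hs,
        by have := hX w (hUU w hw); omega, ?_⟩
      have hsp : SparseTo (F w) h (bad w) (X w) := fun x hx => (Finset.mem_filter.1 hx).2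
      rcases hF w with e | e
      · exact .inl (e ▸ hsp)
      · exact .inr (e ▸ hsp)

theorem SparseTo.exists_card_eq {h q : ℕ} {A B : Finset V}
    (hAB : SparseTo G (4 * h) A B) (hA : 2 * q ≤ A.card) (hB : 2 * q ≤ B.card) :
    ∃ A' ⊆ A, ∃ B' ⊆ B, A'.card = q ∧ B'.card = q ∧ SparseTo G h A' B' := by
  have h1 := SparseTo.card_le (h := 2 * h) (A := A) (B := B) (by
    rwa [← mul_assoc])
  obtain ⟨B', hB', hB'c⟩ := Finset.exists_subset_card_eq (s := B.filter fun b =>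
    2 * h * (A.filter (G.Adj b)).card ≤ A.card) (n := q) (by omega)
  have h2 : SparseTo G (2 * h) B' A := fun b hb => (Finset.mem_filter.1 (hB' hb)).2
  have h3 := h2.card_le
  obtain ⟨A', hA', hA'c⟩ := Finset.exists_subset_card_eq (s := A.filter fun a =>
    h * (B'.filter (G.Adj a)).card ≤ B'.card) (n := q) (by omega)
  exact ⟨A', hA'.trans (Finset.filter_subset _ _), B', hB'.trans (Finset.filter_subset _ _), hA'c,
    hB'c, fun a ha => (Finset.mem_filter.1 (hA' ha)).2⟩

/-- A graph without an induced copy of `H` has linear pairs of prescribed size that are sparse in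
the graph or in its complement. -/
theorem exists_sparseTo_card_eq {W : Type v} [Fintype W] (H : SimpleGraph W) {h : ℕ}
    (hh : 0 < h) : ∃ K : ℕ, ∀ {V : Type u} {G : SimpleGraph V}, ¬ H.IsIndContained G →
      ∀ (q : ℕ) (W₀ : Finset V), 0 < q → K * q ≤ W₀.card →
        ∃ A ⊆ W₀, ∃ B ⊆ W₀, Disjoint A B ∧ A.card = q ∧ B.card = q ∧
          (SparseTo G h A B ∨ SparseTo Gᶜ h A B) := by
  let k := Fintype.card W
  let c := (4 * h * k) ^ k * 2 + 1
  refine ⟨k * c + 1, fun {V} {G} hG q W₀ hq hW₀ => ?_⟩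
  have hne : Nonempty V := by
    obtain ⟨x, -⟩ : W₀.Nonempty := Finset.card_pos.1
      ((Nat.mul_pos (Nat.succ_pos _) hq).trans_le hW₀)
    exact ⟨x⟩
  obtain ⟨g⟩ : Nonempty (W × Fin (c * q) ↪ W₀) := by
    refine Function.Embedding.nonempty_of_card_le ?_
    rw [Fintype.card_prod, Fintype.card_fin, Fintype.card_coe]
    calc k * (c * q) ≤ (k * c + 1) * q := by nlinarith
      _ ≤ _ := hW₀
  let X : W → Finset V := fun w => Finset.univ.map
    ⟨fun t => (g (w, t) : V), fun a b e => by simpa using g.injective (Subtype.ext e)⟩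
  have hXW : ∀ w, X w ⊆ W₀ := by
    intro w x hx
    obtain ⟨t, -, rfl⟩ := Finset.mem_map.1 hx
    exact (g (w, t)).2
  have hdisj : ∀ v w, v ≠ w → Disjoint (X v) (X w) := by
    intro v w hvw
    rw [Finset.disjoint_left]
    intro x hx hx'
    obtain ⟨a, -, rfl⟩ := Finset.mem_map.1 hx
    obtain ⟨b, -, hb⟩ := Finset.mem_map.1 hx'
    have := g.injective (Subtype.ext hb)
    simp only [Prod.mk.injEq] at this
    exact hvw this.1.symm
  rcases exists_embedding_or_sparseTo (G := G) H (h := 4 * h) (k := k) (s := 2 * q) (by omega) W₀ k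
    le_rfl Finset.univ X rfl (fun w _ => hXW w) (fun v _ w _ hvw => hdisj v w hvw) (fun w _ => by
      have : (X w).card = c * q := by simp [X]
      rw [this]
      calc (4 * h * k) ^ k * (2 * q) < (4 * h * k) ^ k * (2 * q) + q := by omega
        _ = c * q := by ring) with ⟨f, hfX, hf⟩ | ⟨A, hA, B, hB, hAB, hAc, hBc, hsp⟩
  · refine (hG ⟨⟨⟨f, fun v w e => ?_⟩, fun {v w} => hf v (Finset.mem_univ v) w
      (Finset.mem_univ w)⟩⟩).elim
    by_contra hvw
    exact Finset.disjoint_left.1 (hdisj v w hvw) (hfX v (Finset.mem_univ v))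
      (e ▸ hfX w (Finset.mem_univ w))
  · rcases hsp with hsp | hsp <;>
      obtain ⟨A', hA', B', hB', hA'c, hB'c, h'⟩ := hsp.exists_card_eq hAc hBc
    · exact ⟨A', hA'.trans hA, B', hB'.trans hB, hAB.mono hA' hB', hA'c, hB'c, .inl h'⟩
    · exact ⟨A', hA'.trans hA, B', hB'.trans hB, hAB.mono hA' hB', hA'c, hB'c, .inr h'⟩

/-- `W` has `2 ^ s * m` vertices, and each has only few neighbours in `W`. For large `s` this bounds
the degrees by a small fraction of the number of vertices. -/
def SparseSet (G : SimpleGraph V) (s m : ℕ) (W : Finset V) : Prop :=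
  W.card = 2 ^ s * m ∧ ∀ v ∈ W, (W.filter (G.Adj v)).card ≤ (s + 1) * m

theorem exists_sparseSet_zero {m : ℕ} {W₀ : Finset V} (hW₀ : m ≤ W₀.card) :
    ∃ W ⊆ W₀, SparseSet G 0 m W := by
  obtain ⟨W, hW, hWc⟩ := Finset.exists_subset_card_eq hW₀
  refine ⟨W, hW, by simpa using hWc, fun v _ => ?_⟩
  simpa [hWc] using Finset.card_filter_le W (G.Adj v)

/-- Two sparse sets found in the two sides of a sparse pair can be chosen so that their union is
sparse as well. -/
theorem SparseTo.exists_sparseSet {s m K h : ℕ} (hs : 2 ^ s ≤ h) (hK : K ≤ h)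
    {Q : Finset V → Prop} {A B : Finset V} (hdisj : Disjoint A B) (hA : A.card = 2 * (K * m))
    (hB : B.card = 2 * (K * m)) (hAB : SparseTo G (2 * h) A B)
    (hfind : ∀ W₀ : Finset V, K * m ≤ W₀.card → ∃ W ⊆ W₀, SparseSet G s m W ∨ Q W) :
    ∃ W ⊆ A ∪ B, SparseSet G (s + 1) m W ∨ Q W := by
  have hh : 0 < h := lt_of_lt_of_le (by positivity) hs
  obtain ⟨A', hA', hA's | hq⟩ := hfind A (by omega)
  swap
  · exact ⟨A', hA'.trans Finset.subset_union_left, .inr hq⟩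
  have hA'B : SparseTo G (2 * h) A' B := fun a ha => hAB a (hA' ha)
  have hhalf := hA'B.card_le
  obtain ⟨B', hB', hB's | hq⟩ := hfind (B.filter fun b => h * (A'.filter (G.Adj b)).card ≤ A'.card)
    (by omega)
  swap
  · exact ⟨B', (hB'.trans (Finset.filter_subset _ _)).trans Finset.subset_union_right, .inr hq⟩
  have hB'B : B' ⊆ B := hB'.trans (Finset.filter_subset _ _)
  have hA'B' : Disjoint A' B' := hdisj.mono hA' hB'B
  refine ⟨A' ∪ B', Finset.union_subset_union hA' hB'B, .inl ⟨?_, ?_⟩⟩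
  · rw [Finset.card_union_of_disjoint hA'B', hA's.1, hB's.1]
    ring
  intro v hv
  rw [Finset.filter_union]
  refine (Finset.card_union_le _ _).trans ?_
  rw [show (s + 1 + 1) * m = (s + 1) * m + m by ring]
  rcases Finset.mem_union.1 hv with hv | hv
  · refine Nat.add_le_add (hA's.2 v hv) ?_
    have h1 := Finset.card_le_card (Finset.filter_subset_filter (G.Adj v) hB'B)
    have h2 := hAB v (hA' hv)
    refine h1.trans (Nat.le_of_mul_le_mul_left (h2.trans ?_) (show 0 < 2 * h by omega))
    rw [hB, ← mul_assoc]
    exact Nat.mul_le_mul_right m (Nat.mul_le_mul_left 2 hK)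
  · rw [add_comm]
    refine Nat.add_le_add (hB's.2 v hv) ?_
    have h2 := (Finset.mem_filter.1 (hB' hv)).2
    rw [hA's.1] at h2
    exact Nat.le_of_mul_le_mul_left (h2.trans (Nat.mul_le_mul_right m hs)) hh

/-- Rödl's theorem: a graph without an induced copy of `H` has a linear set of vertices on which the
graph or its complement is sparse. -/
theorem exists_sparseSet {W : Type v} [Fintype W] (H : SimpleGraph W) : ∀ s t : ℕ,
    ∃ K : ℕ, ∀ {V : Type u} {G : SimpleGraph V}, ¬ H.IsIndContained G →
      ∀ (m : ℕ) (W₀ : Finset V), 0 < m → K * m ≤ W₀.card →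
        ∃ U ⊆ W₀, SparseSet G s m U ∨ SparseSet Gᶜ t m U
  | 0, t => ⟨1, fun {V} {G} _ m W₀ _ hW₀ => by
      obtain ⟨U, hU, h⟩ := exists_sparseSet_zero (G := G) (by simpa using hW₀)
      exact ⟨U, hU, .inl h⟩⟩
  | s + 1, 0 => ⟨1, fun {V} {G} _ m W₀ _ hW₀ => by
      obtain ⟨U, hU, h⟩ := exists_sparseSet_zero (G := Gᶜ) (by simpa using hW₀)
      exact ⟨U, hU, .inr h⟩⟩
  | s + 1, t + 1 => by
    obtain ⟨K₁, hK₁⟩ := exists_sparseSet H s (t + 1)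
    obtain ⟨K₂, hK₂⟩ := exists_sparseSet H (s + 1) t
    obtain ⟨K, hK⟩ : ∃ K, K = K₁ + K₂ + 1 := ⟨_, rfl⟩
    obtain ⟨h, hh⟩ : ∃ h, h = 2 ^ s + 2 ^ t + K := ⟨_, rfl⟩
    have hs : 0 < 2 ^ s := by positivity
    have ht : 0 < 2 ^ t := by positivity
    obtain ⟨K₀, hK₀⟩ := exists_sparseTo_card_eq (h := 2 * h) H (by omega)
    refine ⟨K₀ * (2 * K), fun {V} {G} hG m W₀ hm hW₀ => ?_⟩
    obtain ⟨A, hA, B, hB, hAB, hAc, hBc, hsp⟩ := hK₀ hG (2 * (K * m)) W₀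
      (Nat.mul_pos two_pos (Nat.mul_pos (by omega) hm))
      (by rwa [show K₀ * (2 * (K * m)) = K₀ * (2 * K) * m by ring])
    have hABW := Finset.union_subset hA hB
    rcases hsp with hsp | hsp
    · obtain ⟨U, hU, h'⟩ := hsp.exists_sparseSet (s := s) (m := m) (K := K) (by omega) (by omega)
        hAB hAc hBc fun W₁ hW₁ => hK₁ hG m W₁ hm (by
          refine le_trans (Nat.mul_le_mul_right m ?_) hW₁
          omega)
      exact ⟨U, hU.trans hABW, h'⟩
    · obtain ⟨U, hU, h'⟩ := hsp.exists_sparseSet (s := t) (m := m) (K := K)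
        (Q := SparseSet G (s + 1) m) (by omega) (by omega) hAB hAc hBc fun W₁ hW₁ => by
          obtain ⟨U, hU, h'⟩ := hK₂ hG m W₁ hm (by
            refine le_trans (Nat.mul_le_mul_right m ?_) hW₁
            omega)
          exact ⟨U, hU, h'.symm⟩
      exact ⟨U, hU.trans hABW, h'.symm⟩

end Rodl

/-! ### Pure pairs and the Erdős–Hajnal property -/

section PurePairs

open scoped Classical

universe u v w

/-- A sparse set in a graph without a given caterpillar subdivision contains two large disjoint sets
with no edge between them: otherwise it would induce a coherent graph. -/
theorem SparseSet.exists_anti {V : Type u} {G : SimpleGraph V} {s m : ℕ} {W : Finset V}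
    (hW : SparseSet G s m W) {d L n₀ : ℕ} (hd : 1 ≤ d)
    (hs : 2 ^ n₀ * 4 ^ (2 ^ n₀) * (2 * L + 5) * (s + 2) ≤ 2 ^ s) (hm : 0 < m)
    (hG : ∀ (n : ℕ) (S : Set W) (x : W), n₀ ≤ n →
      ¬ Has (G.comap (Function.Embedding.subtype (· ∈ W))) (RTree.cat d L n) S x) :
    ∃ A ⊆ W, ∃ B ⊆ W, Disjoint A B ∧ m ≤ A.card ∧ m ≤ B.card ∧
      ∀ a ∈ A, ∀ b ∈ B, ¬ G.Adj a b := by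
  by_contra! hcon
  have hsub : ∀ A : Finset W, A.map (Function.Embedding.subtype _) ⊆ W := by
    intro A x hx
    obtain ⟨y, -, rfl⟩ := Finset.mem_map.1 hx
    exact y.2
  have hcoh : Coherent (G.comap (Function.Embedding.subtype (· ∈ W))) ((s + 1) * m + 1) := by
    refine ⟨fun v X => Nat.lt_succ_of_le ?_, fun A B hAB hA hB => ?_⟩
    · rw [← Finset.card_map (Function.Embedding.subtype (· ∈ W))]
      refine (Finset.card_le_card fun x hx => ?_).trans (hW.2 v v.2)
      obtain ⟨y, hy, rfl⟩ := Finset.mem_map.1 hx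
      exact Finset.mem_filter.2 ⟨y.2, (Finset.mem_filter.1 hy).2⟩
    · have hmE : m ≤ (s + 1) * m + 1 := by nlinarith
      obtain ⟨a, ha, b, hb, hab⟩ := hcon _ (hsub A) _ (hsub B)
        ((Finset.disjoint_map _).2 hAB) (by rw [Finset.card_map]; omega)
        (by rw [Finset.card_map]; omega)
      obtain ⟨a', ha', rfl⟩ := Finset.mem_map.1 ha
      obtain ⟨b', hb', rfl⟩ := Finset.mem_map.1 hb
      exact ⟨a', ha', b', hb', hab⟩
  obtain ⟨n, x, S, hn, hhas⟩ := hcoh.exists_has (by omega) (L := L) hd n₀ (by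
    rw [Fintype.card_coe, hW.1]
    calc 2 ^ n₀ * 4 ^ (2 ^ n₀) * (2 * L + 5) * ((s + 1) * m + 1)
        ≤ 2 ^ n₀ * 4 ^ (2 ^ n₀) * (2 * L + 5) * ((s + 2) * m) :=
          Nat.mul_le_mul_left _ (by nlinarith)
      _ = 2 ^ n₀ * 4 ^ (2 ^ n₀) * (2 * L + 5) * (s + 2) * m := by ring
      _ ≤ 2 ^ s * m := Nat.mul_le_mul_right m hs)
  exact hG n S x hn hhas

theorem exists_mul_le_two_pow (c : ℕ) : ∃ s : ℕ, c * (s + 2) ≤ 2 ^ s := by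
  refine ⟨3 * (c + 2), ?_⟩
  have h : c + 3 ≤ 2 ^ (c + 2) := Nat.lt_two_pow_self
  calc c * (3 * (c + 2) + 2) ≤ c * (3 * (c + 2) + 2) + (c ^ 3 + 6 * c ^ 2 + 19 * c + 27) :=
        Nat.le_add_right _ _
    _ = (c + 3) ^ 3 := by ring
    _ ≤ (2 ^ (c + 2)) ^ 3 := Nat.pow_le_pow_left h 3
    _ = 2 ^ (3 * (c + 2)) := by rw [← pow_mul, mul_comm]

/-- The strong Erdős–Hajnal property: if `G` has no induced `H` and its complement no induced `J`,
then every set of at least two vertices has two disjoint linear subsets that are completely joined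
or not joined at all. -/
theorem exists_pure_pair {V : Type v} {W : Type w} [Fintype V] [Fintype W] {H : SimpleGraph V}
    [DecidableRel H.Adj] {J : SimpleGraph W} [DecidableRel J.Adj]
    (hH : H.IsCaterpillarSubdivision) (hJ : J.IsCaterpillarSubdivision) :
    ∃ t : ℕ, 0 < t ∧ ∀ {X : Type u} (G : SimpleGraph X), ¬ H.IsIndContained G →
      ¬ J.IsIndContained Gᶜ → ∀ Y : Finset X, 2 ≤ Y.card → ∃ A ⊆ Y, ∃ B ⊆ Y, Disjoint A B ∧
        Y.card ≤ t * A.card ∧ Y.card ≤ t * B.card ∧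
        ((∀ a ∈ A, ∀ b ∈ B, ¬ G.Adj a b) ∨ ∀ a ∈ A, ∀ b ∈ B, ¬ Gᶜ.Adj a b) := by
  obtain ⟨N₁, hN₁⟩ := exists_bound_of_isCaterpillarSubdivision hH
  obtain ⟨N₂, hN₂⟩ := exists_bound_of_isCaterpillarSubdivision hJ
  let d := N₁ + N₂ + 1
  let n₀ := (d + 1) * d
  obtain ⟨s, hs⟩ := exists_mul_le_two_pow (2 ^ n₀ * 4 ^ (2 ^ n₀) * (2 * d + 5))
  obtain ⟨K, hK⟩ := exists_sparseSet H s s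
  refine ⟨2 * (K + 1), by omega, fun {X} G hHG hJG Y hY => ?_⟩
  rcases lt_or_ge Y.card (K + 1) with hlt | hge
  · obtain ⟨a, ha, b, hb, hab⟩ := Finset.one_lt_card.1 hY
    refine ⟨{a}, by simpa using ha, {b}, by simpa using hb, by simpa using hab,
      by simp; omega, by simp; omega, ?_⟩
    by_cases h : G.Adj a b <;> simp [h]
  · let m := Y.card / (K + 1)
    have hm : 0 < m := Nat.div_pos hge (by omega)
    have hmY : (K + 1) * m ≤ Y.card := Nat.mul_div_le _ _
    have hYm : Y.card ≤ 2 * (K + 1) * m := by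
      have := Nat.lt_mul_div_succ Y.card (show 0 < K + 1 by omega)
      change Y.card < (K + 1) * (m + 1) at this
      nlinarith
    have hcat : ∀ {F : SimpleGraph X} (U : Finset X), (∀ (n : ℕ) (S : Set U) (x : U), n₀ ≤ n →
        ¬ Has (F.comap (Function.Embedding.subtype (· ∈ U))) (RTree.cat d d n) S x) →
        SparseSet F s m U → U ⊆ Y → ∃ A ⊆ Y, ∃ B ⊆ Y, Disjoint A B ∧
          Y.card ≤ 2 * (K + 1) * A.card ∧ Y.card ≤ 2 * (K + 1) * B.card ∧
          ∀ a ∈ A, ∀ b ∈ B, ¬ F.Adj a b := by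
      intro F U hU hUs hUY
      obtain ⟨A, hA, B, hB, hAB, hAm, hBm, h⟩ :=
        hUs.exists_anti (by omega) hs hm hU
      exact ⟨A, hA.trans hUY, B, hB.trans hUY, hAB, hYm.trans (Nat.mul_le_mul_left _ hAm),
        hYm.trans (Nat.mul_le_mul_left _ hBm), h⟩
    have hle : ∀ {N : ℕ}, N ≤ d → (d + 1) * N ≤ n₀ := fun h => Nat.mul_le_mul_left _ h
    obtain ⟨U, hUY, hU | hU⟩ := hK hHG m Y hm (by nlinarith)
    · obtain ⟨A, hA, B, hB, hAB, hAY, hBY, h⟩ := hcat (F := G) U (fun n S x hn h =>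
        hHG ((hN₁ d d n (by omega) (by omega) ((hle (by omega)).trans hn) _ S x h).trans
          ⟨SimpleGraph.Embedding.comap _ G⟩)) hU hUY
      exact ⟨A, hA, B, hB, hAB, hAY, hBY, .inl h⟩
    · obtain ⟨A, hA, B, hB, hAB, hAY, hBY, h⟩ := hcat (F := Gᶜ) U (fun n S x hn h =>
        hJG ((hN₂ d d n (by omega) (by omega) ((hle (by omega)).trans hn) _ S x h).trans
          ⟨SimpleGraph.Embedding.comap _ Gᶜ⟩)) hU hUY
      exact ⟨A, hA, B, hB, hAB, hAY, hBY, .inr h⟩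

/-- `Y` contains a clique and a stable set the product of whose sizes is at least the `t`-th root of
the size of `Y`. -/
def LargeProduct {X : Type u} (G : SimpleGraph X) (t : ℕ) (Y : Finset X) : Prop :=
  ∃ Q ⊆ Y, ∃ R ⊆ Y, G.IsClique Q ∧ G.IsIndepSet R ∧ Y.card ≤ (Q.card * R.card) ^ t

theorem LargeProduct.of_compl {X : Type u} {G : SimpleGraph X} {t : ℕ} {Y : Finset X}
    (h : LargeProduct Gᶜ t Y) : LargeProduct G t Y := by
  obtain ⟨Q, hQ, R, hR, hQc, hRi, hc⟩ := h
  exact ⟨R, hR, Q, hQ, by simpa using hRi, by simpa using hQc, by rwa [mul_comm]⟩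

/-- In two sets with no edge between them, the stable sets add up. -/
theorem LargeProduct.of_anti {X : Type u} {G : SimpleGraph X} {t : ℕ} {Y A B : Finset X}
    (hA : LargeProduct G t A) (hB : LargeProduct G t B) (hAY : A ⊆ Y) (hBY : B ⊆ Y)
    (hAB : Disjoint A B) (hanti : ∀ a ∈ A, ∀ b ∈ B, ¬ G.Adj a b) (hAc : Y.card ≤ t * A.card)
    (hBc : Y.card ≤ t * B.card) : LargeProduct G t Y := by
  obtain ⟨Q₁, hQ₁, R₁, hR₁, hQ₁c, hR₁i, h₁⟩ := hA
  obtain ⟨Q₂, hQ₂, R₂, hR₂, hQ₂c, hR₂i, h₂⟩ := hB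
  have hRi : G.IsIndepSet (R₁ ∪ R₂ : Finset X) := by
    intro x hx y hy hxy
    rcases Finset.mem_union.1 (Finset.mem_coe.1 hx) with hx | hx <;>
      rcases Finset.mem_union.1 (Finset.mem_coe.1 hy) with hy | hy
    · exact hR₁i hx hy hxy
    · exact hanti x (hR₁ hx) y (hR₂ hy)
    · exact fun h => hanti y (hR₁ hy) x (hR₂ hx) h.symm
    · exact hR₂i hx hy hxy
  have hRc : (R₁ ∪ R₂).card = R₁.card + R₂.card :=
    Finset.card_union_of_disjoint (hAB.mono hR₁ hR₂)
  have hR : R₁ ∪ R₂ ⊆ Y := Finset.union_subset (hR₁.trans hAY) (hR₂.trans hBY)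
  have ht : t ≤ 2 ^ t := Nat.lt_two_pow_self.le
  have e₁ : Y.card ≤ (2 * (Q₁.card * R₁.card)) ^ t := by
    rw [mul_pow]
    exact hAc.trans (Nat.mul_le_mul ht h₁)
  have e₂ : Y.card ≤ (2 * (Q₂.card * R₂.card)) ^ t := by
    rw [mul_pow]
    exact hBc.trans (Nat.mul_le_mul ht h₂)
  have key : ∀ q, Q₁.card ≤ q → Q₂.card ≤ q → Y.card ≤ (q * (R₁.card + R₂.card)) ^ t := by
    intro q hq₁ hq₂
    have f₁ := Nat.mul_le_mul_right R₁.card hq₁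
    have f₂ := Nat.mul_le_mul_right R₂.card hq₂
    have f : q * (R₁.card + R₂.card) = q * R₁.card + q * R₂.card := Nat.mul_add _ _ _
    rcases le_total (Q₁.card * R₁.card) (Q₂.card * R₂.card) with h | h
    · exact e₁.trans (Nat.pow_le_pow_left (by omega) t)
    · exact e₂.trans (Nat.pow_le_pow_left (by omega) t)
  rcases le_total Q₁.card Q₂.card with h | h
  · exact ⟨Q₂, hQ₂.trans hBY, _, hR, hQ₂c, hRi, by rw [hRc]; exact key _ h le_rfl⟩
  · exact ⟨Q₁, hQ₁.trans hAY, _, hR, hQ₁c, hRi, by rw [hRc]; exact key _ le_rfl h⟩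

theorem largeProduct_of_pure_pairs {X : Type u} {G : SimpleGraph X} {t : ℕ}
    (hG : ∀ Y : Finset X, 2 ≤ Y.card → ∃ A ⊆ Y, ∃ B ⊆ Y, Disjoint A B ∧
      Y.card ≤ t * A.card ∧ Y.card ≤ t * B.card ∧
      ((∀ a ∈ A, ∀ b ∈ B, ¬ G.Adj a b) ∨ ∀ a ∈ A, ∀ b ∈ B, ¬ Gᶜ.Adj a b)) (Y : Finset X)
    (hY : Y.Nonempty) : LargeProduct G t Y ∧ LargeProduct Gᶜ t Y := by
  induction Y using Finset.strongInduction with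
  | H Y ih =>
    rcases lt_or_ge Y.card 2 with hlt | hge
    · obtain ⟨x, rfl⟩ := Finset.card_eq_one.1 (show Y.card = 1 by have := hY.card_pos; omega)
      exact ⟨⟨{x}, subset_rfl, {x}, subset_rfl, by simp, by simp, by simp⟩,
        ⟨{x}, subset_rfl, {x}, subset_rfl, by simp, by simp, by simp⟩⟩
    · obtain ⟨A, hA, B, hB, hAB, hAc, hBc, h⟩ := hG Y hge
      have hpos : ∀ C : Finset X, Y.card ≤ t * C.card → C.Nonempty := fun C hC => by
        rw [← Finset.card_pos]
        exact Nat.pos_of_ne_zero fun e => by simp [e] at hC; simp [hC] at hge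
      have hssub : ∀ C D : Finset X, C ⊆ Y → D ⊆ Y → Disjoint C D → D.Nonempty → C ⊂ Y := by
        rintro C D hC hD hCD ⟨x, hx⟩
        exact ⟨hC, fun h => Finset.disjoint_left.1 hCD (h (hD hx)) hx⟩
      obtain ⟨hA₁, hA₂⟩ := ih A (hssub A B hA hB hAB (hpos B hBc)) (hpos A hAc)
      obtain ⟨hB₁, hB₂⟩ := ih B (hssub B A hB hA hAB.symm (hpos A hAc)) (hpos B hBc)
      have : LargeProduct G t Y := by
        rcases h with h | h
        · exact hA₁.of_anti hB₁ hA hB hAB h hAc hBc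
        · exact (hA₂.of_anti hB₂ hA hB hAB h hAc hBc).of_compl
      exact ⟨this, LargeProduct.of_compl (by rwa [compl_compl])⟩

end PurePairs

end CaterpillarEH

theorem mainTheorem3 {V W : Type*} [Fintype V] [Fintype W]
    (H : SimpleGraph V) [DecidableRel H.Adj] (J : SimpleGraph W) [DecidableRel J.Adj]
    (hH : H.IsCaterpillarSubdivision) (hJ : J.IsCaterpillarSubdivision) :
    ∃ c : ℝ, 0 < c ∧ ∀ {X : Type*} [Fintype X] (G : SimpleGraph X),
      G.IsInducedFree H → G.IsInducedFree Jᶜ →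
        (Fintype.card X : ℝ) ^ c ≤ (max G.cliqueNum G.indepNum : ℕ) := by
  obtain ⟨t, ht, hpure⟩ := CaterpillarEH.exists_pure_pair hH hJ
  have ht' : (0 : ℝ) < (2 * t : ℕ) := by exact_mod_cast Nat.mul_pos two_pos ht
  refine ⟨((2 * t : ℕ) : ℝ)⁻¹, inv_pos.2 ht', fun {X} _ G hHG hJG => ?_⟩
  rw [SimpleGraph.isInducedFree_iff] at hHG hJG
  have hJG' : ¬ J.IsIndContained Gᶜ := fun ⟨f⟩ =>
    hJG ⟨by simpa using SimpleGraph.Embedding.complEquiv f⟩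
  rcases isEmpty_or_nonempty X with hX | hX
  · rw [Fintype.card_eq_zero, Nat.cast_zero, Real.zero_rpow (inv_pos.2 ht').ne']
    exact Nat.cast_nonneg _
  obtain ⟨⟨Q, -, R, -, hQ, hR, hc⟩, -⟩ := CaterpillarEH.largeProduct_of_pure_pairs
    (hpure G hHG hJG') Finset.univ Finset.univ_nonempty
  have hQ' : Q.card ≤ max G.cliqueNum G.indepNum := hQ.card_le_cliqueNum.trans (le_max_left _ _)
  have hR' : R.card ≤ max G.cliqueNum G.indepNum := hR.card_le_indepNum.trans (le_max_right _ _)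
  have hle : Fintype.card X ≤ max G.cliqueNum G.indepNum ^ (2 * t) := by
    rw [pow_mul, sq]
    exact hc.trans (Nat.pow_le_pow_left (Nat.mul_le_mul hQ' hR') t)
  rw [Real.rpow_inv_le_iff_of_pos (Nat.cast_nonneg _) (Nat.cast_nonneg _) ht', Real.rpow_natCast]
  exact_mod_cast hle
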